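/- Let $G$ be a connected Lie group, $\Lambda\subset G$ a discrete subgroup such that $X=G/\Lambda$ is compact. An affine transformation of $X$ is a map $f(h\Lambda)=g\,a(h)\Lambda$ with $g\in G$ and $a$ an automorphism of the Lie group $G$ with $a(\Lambda)=\Lambda$; write $\mathrm{Aff}(X)$ for the group of these maps and $Df=\mathrm{Ad}(g)\circ D(a)_e\in \mathrm{GL}(\mathrm{Lie}(G))$. Let $W^{min}_f\subset\mathrm{Lie}(G)$ be the sum of the generalized eigenspaces of $Df$ with eigenvalues of minimal modulus and $P^{min}_f$ the projection onto $W^{min}_f$ along the other generalized eigenspaces. A finite family $g_1,\dots,g_l\in\mathrm{Aff}(X)$ is essential for $f_0\in\mathrm{Aff}(X)$ if there is $\eta>0$ with $\max_k\|P^{min}_{f_0}(Dg_k)v\|>\eta\|v\|$ for all $v\in\mathrm{Lie}(G)\setminus\{0\}$ (for one, equivalently any, norm). Let $\vartheta>0$ and let $f_0\in\mathrm{Aff}(X)$ be such that the restriction of $Df_0$ to $W^{min}_{f_0}$ is semisimple. Then there exists $\nu=\nu(\vartheta,f_0)>1$ such that the following holds for every smooth Riemannian metric on $X$, with distance $d$.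 Given $a>0$ and an essential family $g_1,\dots,g_l\in\mathrm{Aff}(X)$ for $f_0$, there is $\epsilon_0>0$ such that for every $0<\epsilon\le\epsilon_0$ and every family of subsets $\mathcal L_\epsilon(x)$, $x\in X$, of $X$ satisfying (i) $x\in\mathcal L_\epsilon(x)\subset B_\epsilon(x)=\{y: d(x,y)<\epsilon\}$ for every $x\in X$, (ii) $f_0^{-1}(\mathcal L_\epsilon(x))\supset\mathcal L_\epsilon(f_0^{-1}(x))$ for every $x\in X$, (iii) $\max_k d(f_0^{-n}g_kf_0^n(x),f_0^{-n}g_kf_0^n(y))\le a\,\nu^n d(x,y)^\vartheta$ for every $x\in X$, $y\in\mathcal L_\epsilon(x)$ and $n\ge0$, one has $\mathcal L_\epsilon(x)\subset\exp(W^{min}_{f_0})x$ for every $x\in X$, where $\exp$ is the Lie exponential map. -/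

import Mathlib

open scoped Manifold ContDiff TensorProduct Bundle

noncomputable section

/-! ### Spectral decomposition of a real endomorphism by moduli of complex eigenvalues -/

namespace RealSpectral

variable {V : Type*} [AddCommGroup V] [Module ℝ V]

/-- The complexification of a real endomorphism. -/
def cx (A : Module.End ℝ V) : Module.End ℂ (ℂ ⊗[ℝ] V) := LinearMap.baseChange ℂ A

/-- The complex sum of the generalized eigenspaces of `A` with eigenvalues in `S`. -/
def cxSum (A : Module.End ℝ V) (S : Set ℂ) : Submodule ℂ (ℂ ⊗[ℝ] V) :=
  ⨆ μ ∈ S, (cx A).maxGenEigenspace μ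

/-- The real vectors in the sum of the generalized eigenspaces of (the complexification of) `A`
with eigenvalues in `S`. -/
def realSum (A : Module.End ℝ V) (S : Set ℂ) : Submodule ℝ V :=
  ((cxSum A S).restrictScalars ℝ).comap (TensorProduct.mk ℝ ℂ V 1)

/-- The complex eigenvalues of `A` of minimal modulus. -/
def minEigenvalues (A : Module.End ℝ V) : Set ℂ :=
  {μ | (cx A).HasEigenvalue μ ∧ ∀ μ', (cx A).HasEigenvalue μ' → ‖μ‖ ≤ ‖μ'‖}

/-- `W^min`: the sum of the generalized eigenspaces with eigenvalues of minimal modulus. -/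
def Wmin (A : Module.End ℝ V) : Submodule ℝ V := realSum A (minEigenvalues A)

/-- The sum of all the other generalized eigenspaces. -/
def Wrest (A : Module.End ℝ V) : Submodule ℝ V := realSum A (minEigenvalues A)ᶜ

lemma realSum_mapsTo (A : Module.End ℝ V) (S : Set ℂ) :
    ∀ v ∈ realSum A S, A v ∈ realSum A S := by
  intro v hv
  have h : cxSum A S ≤ (cxSum A S).comap (cx A) := by
    refine iSup₂_le fun μ hμ z hz => ?_
    have h1 : (cx A).maxGenEigenspace μ ≤ cxSum A S :=
      le_iSup₂_of_le (f := fun μ (_ : μ ∈ S) => (cx A).maxGenEigenspace μ) μ hμ le_rfl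
    exact h1 ((cx A).mapsTo_maxGenEigenspace_of_comm (Commute.refl _) μ hz)
  have := h (show (1 : ℂ) ⊗ₜ[ℝ] v ∈ cxSum A S from hv)
  simpa [cx, realSum] using this

/-- Complex conjugation on the complexification. -/
def conjMap : (ℂ ⊗[ℝ] V) →ₗ[ℝ] (ℂ ⊗[ℝ] V) :=
  LinearMap.rTensor V Complex.conjAe.toLinearMap

lemma conjMap_smul (c : ℂ) (z : ℂ ⊗[ℝ] V) :
    conjMap (c • z) = (starRingEnd ℂ c) • conjMap z := by
  induction z with
  | zero => simp
  | tmul a v => simp [conjMap, TensorProduct.smul_tmul']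
  | add x y hx hy => simp [hx, hy]

lemma conjMap_conjMap (z : ℂ ⊗[ℝ] V) : conjMap (conjMap z) = z := by
  induction z with
  | zero => simp
  | tmul a v => simp [conjMap]
  | add x y hx hy => simp [hx, hy]

lemma conjMap_cx (A : Module.End ℝ V) (z : ℂ ⊗[ℝ] V) :
    conjMap (cx A z) = cx A (conjMap z) := by
  induction z with
  | zero => simp
  | tmul a v => simp [conjMap, cx]
  | add x y hx hy => simp [hx, hy]

lemma conjMap_pow (A : Module.End ℝ V) (μ : ℂ) (k : ℕ) (z : ℂ ⊗[ℝ] V) :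
    conjMap (((cx A - μ • 1) ^ k) z)
      = ((cx A - (starRingEnd ℂ μ) • (1 : Module.End ℂ (ℂ ⊗[ℝ] V))) ^ k) (conjMap z) := by
  induction k generalizing z with
  | zero => simp
  | succ k ih =>
    rw [pow_succ, pow_succ, Module.End.mul_apply, Module.End.mul_apply, ih]
    simp [conjMap_cx, conjMap_smul]

lemma conjMap_mem (A : Module.End ℝ V) (μ : ℂ) (z : ℂ ⊗[ℝ] V)
    (hz : z ∈ (cx A).maxGenEigenspace μ) :
    conjMap z ∈ (cx A).maxGenEigenspace (starRingEnd ℂ μ) := by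
  rw [Module.End.mem_maxGenEigenspace] at hz ⊢
  obtain ⟨k, hk⟩ := hz
  exact ⟨k, by rw [← conjMap_pow, hk, map_zero]⟩

lemma conjMap_mem_cxSum (A : Module.End ℝ V) (S : Set ℂ)
    (hS : ∀ μ ∈ S, starRingEnd ℂ μ ∈ S) (z : ℂ ⊗[ℝ] V) (hz : z ∈ cxSum A S) :
    conjMap z ∈ cxSum A S := by
  have h : ∀ w ∈ cxSum A S, conjMap w ∈ cxSum A S := by
    intro w hw
    unfold cxSum at hw
    rw [iSup_subtype'] at hw
    induction hw using Submodule.iSup_induction' with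
    | mem i x hx =>
      exact (le_iSup₂_of_le (f := fun μ (_ : μ ∈ S) => (cx A).maxGenEigenspace μ)
        (starRingEnd ℂ i.1) (hS _ i.2) le_rfl) (conjMap_mem A _ _ hx)
    | zero => simp
    | add x y _ _ hx hy => rw [map_add]; exact add_mem hx hy
  exact h z hz

lemma hasEigenvalue_conj (A : Module.End ℝ V) (μ : ℂ) (h : (cx A).HasEigenvalue μ) :
    (cx A).HasEigenvalue (starRingEnd ℂ μ) := by
  obtain ⟨z, hz, hz0⟩ := h.exists_hasEigenvector
  refine Module.End.hasEigenvalue_of_hasEigenvector (x := conjMap z) ⟨?_, ?_⟩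
  · rw [Module.End.mem_eigenspace_iff] at hz ⊢
    rw [← conjMap_cx, hz, conjMap_smul]
  · intro h0
    exact hz0 (by rw [← conjMap_conjMap z, h0, map_zero])

lemma minEigenvalues_conj (A : Module.End ℝ V) :
    ∀ μ ∈ minEigenvalues A, starRingEnd ℂ μ ∈ minEigenvalues A := fun μ h =>
  ⟨hasEigenvalue_conj A μ h.1, fun μ' h' => by rw [Complex.norm_conj]; exact h.2 μ' h'⟩

lemma minEigenvalues_compl_conj (A : Module.End ℝ V) :
    ∀ μ ∈ (minEigenvalues A)ᶜ, starRingEnd ℂ μ ∈ (minEigenvalues A)ᶜ := fun μ h h' =>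
  h (by simpa using minEigenvalues_conj A _ h')

/-- A vector of the complexification that is fixed by conjugation is real. -/
lemma exists_real (z : ℂ ⊗[ℝ] V) (hz : conjMap z = z) : ∃ v : V, z = (1 : ℂ) ⊗ₜ[ℝ] v := by
  have key : ∀ z : ℂ ⊗[ℝ] V, ∃ v : V, z + conjMap z = (1 : ℂ) ⊗ₜ[ℝ] v := by
    intro z
    induction z with
    | zero => exact ⟨0, by simp⟩
    | tmul a v =>
      refine ⟨(2 * a.re) • v, ?_⟩
      rw [← TensorProduct.smul_tmul]
      simp only [conjMap, LinearMap.rTensor_tmul, ← TensorProduct.add_tmul]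
      congr 1
      apply Complex.ext
      · simp; ring
      · simp
    | add x y hx hy =>
      obtain ⟨v, hv⟩ := hx
      obtain ⟨w, hw⟩ := hy
      refine ⟨v + w, ?_⟩
      rw [TensorProduct.tmul_add, ← hv, ← hw, map_add]
      abel
  obtain ⟨v, hv⟩ := key z
  refine ⟨(2⁻¹ : ℝ) • v, ?_⟩
  rw [TensorProduct.tmul_smul, ← hv, hz, ← two_smul ℝ z, smul_smul]
  norm_num

lemma isCompl_cx [FiniteDimensional ℝ V] (A : Module.End ℝ V) (S : Set ℂ) :
    IsCompl (cxSum A S) (cxSum A Sᶜ) := by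
  constructor
  · exact (cx A).independent_maxGenEigenspace.disjoint_biSup_biSup disjoint_compl_right
  · rw [codisjoint_iff, eq_top_iff, ← (cx A).iSup_maxGenEigenspace_eq_top]
    refine iSup_le fun μ => ?_
    by_cases h : μ ∈ S
    · exact le_sup_of_le_left
        (le_iSup₂_of_le (f := fun μ (_ : μ ∈ S) => (cx A).maxGenEigenspace μ) μ h le_rfl)
    · exact le_sup_of_le_right
        (le_iSup₂_of_le (f := fun μ (_ : μ ∈ Sᶜ) => (cx A).maxGenEigenspace μ) μ h le_rfl)

lemma isCompl_Wmin [FiniteDimensional ℝ V] (A : Module.End ℝ V) :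
    IsCompl (Wmin A) (Wrest A) := by
  have hc := isCompl_cx A (minEigenvalues A)
  constructor
  · rw [Submodule.disjoint_def]
    intro v h1 h2
    have h0 : (1 : ℂ) ⊗ₜ[ℝ] v = 0 := (Submodule.disjoint_def.1 hc.1) _ h1 h2
    have hinj : Function.Injective (TensorProduct.mk ℝ ℂ V 1) :=
      Module.FaithfullyFlat.tensorProduct_mk_injective V
    exact hinj (by simpa using h0)
  · rw [codisjoint_iff, eq_top_iff]
    intro v _
    have hv : (1 : ℂ) ⊗ₜ[ℝ] v ∈ cxSum A (minEigenvalues A) ⊔ cxSum A (minEigenvalues A)ᶜ := by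
      rw [hc.sup_eq_top]; trivial
    obtain ⟨p, hp, q, hq, hpq⟩ := Submodule.mem_sup.1 hv
    have hcp := conjMap_mem_cxSum A _ (minEigenvalues_conj A) p hp
    have hcq := conjMap_mem_cxSum A _ (minEigenvalues_compl_conj A) q hq
    have hsum : conjMap p + conjMap q = p + q := by
      rw [← map_add, hpq]; simp [conjMap]
    have hd : conjMap p - p = q - conjMap q := by
      rw [sub_eq_sub_iff_add_eq_add, hsum, add_comm]
    have hz : conjMap p - p = 0 :=
      (Submodule.disjoint_def.1 hc.1) _ (sub_mem hcp hp) (hd ▸ sub_mem hq hcq)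
    obtain ⟨a, ha⟩ := exists_real p (sub_eq_zero.1 hz)
    obtain ⟨b, hb⟩ := exists_real q (sub_eq_zero.1 (hd ▸ hz)).symm
    refine Submodule.mem_sup.2 ⟨a, ?_, b, ?_, ?_⟩
    · change (1 : ℂ) ⊗ₜ[ℝ] a ∈ cxSum A _
      exact ha ▸ hp
    · change (1 : ℂ) ⊗ₜ[ℝ] b ∈ cxSum A _
      exact hb ▸ hq
    · have hinj : Function.Injective (TensorProduct.mk ℝ ℂ V 1) :=
        Module.FaithfullyFlat.tensorProduct_mk_injective V
      apply hinj
      simp only [TensorProduct.mk_apply, TensorProduct.tmul_add, ← ha, ← hb, hpq]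

/-- `P^min`: the projection onto `W^min` along the other generalized eigenspaces. -/
def Pmin [FiniteDimensional ℝ V] (A : Module.End ℝ V) : Module.End ℝ V :=
  (Wmin A).projection (Wrest A) (isCompl_Wmin A)

/-- The restriction of `A` to the invariant subspace `W^min`. -/
def restrictWmin (A : Module.End ℝ V) : Module.End ℝ (Wmin A) :=
  LinearMap.restrict A (realSum_mapsTo A (minEigenvalues A))

end RealSpectral

/-! ### Affine maps of homogeneous spaces -/

namespace HomogeneousSpace

section

variable {E : Type*} [NormedAddCommGroup E] [NormedSpace ℝ E]
  {G : Type*} [TopologicalSpace G] [ChartedSpace E G] [Group G]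

variable (E) in
/-- An automorphism of the Lie group `G`: a group automorphism that is a diffeomorphism. -/
structure LieAut (G : Type*) [TopologicalSpace G] [ChartedSpace E G] [Group G]
    extends G ≃* G where
  smooth_toFun : ContMDiff 𝓘(ℝ, E) 𝓘(ℝ, E) ∞ toFun
  smooth_invFun : ContMDiff 𝓘(ℝ, E) 𝓘(ℝ, E) ∞ invFun

/-- The differential at the identity of a group endomorphism, as an endomorphism of the Lie
algebra. All tangent spaces of `G` are by definition copies of `E`, and this identifies the
tangent space at `φ 1 = 1` with the tangent space at `1`. -/
def diffOne (φ : G →* G) :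
    GroupLieAlgebra 𝓘(ℝ, E) G →L[ℝ] GroupLieAlgebra 𝓘(ℝ, E) G :=
  (mfderiv 𝓘(ℝ, E) 𝓘(ℝ, E) φ (1 : G) : E →L[ℝ] E)

/-- The adjoint representation: the differential at the identity of `x ↦ g x g⁻¹`. -/
def Ad (g : G) : GroupLieAlgebra 𝓘(ℝ, E) G →L[ℝ] GroupLieAlgebra 𝓘(ℝ, E) G :=
  diffOne (MulAut.conj g).toMonoidHom

variable (E) in
/-- An affine transformation `x ↦ g · a(x)` of `G ⧸ Λ`: the translation part `g`, and an
automorphism `a` of the Lie group `G` with `a(Λ) = Λ`. -/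
structure Aff (Λ : Subgroup G) where
  g : G
  a : LieAut E G
  map_eq : Λ.map a.toMulEquiv.toMonoidHom = Λ

namespace Aff

variable {Λ : Subgroup G}

lemma mem_iff (f : Aff E Λ) (x : G) : f.a.toMulEquiv x ∈ Λ ↔ x ∈ Λ := by
  constructor
  · intro h
    obtain ⟨y, hy, hyx⟩ := f.map_eq.ge h
    exact f.a.toMulEquiv.injective hyx ▸ hy
  · intro h
    exact f.map_eq.le ⟨x, h, rfl⟩

/-- The bijection of `G ⧸ Λ` defined by an affine transformation: `hΛ ↦ g a(h)Λ`. -/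
def toPerm (f : Aff E Λ) : Equiv.Perm (G ⧸ Λ) where
  toFun := Quotient.map' (fun h => f.g * f.a.toMulEquiv h) (by
    intro h k hk
    rw [QuotientGroup.leftRel_apply] at hk ⊢
    have : (f.g * f.a.toMulEquiv h)⁻¹ * (f.g * f.a.toMulEquiv k) = f.a.toMulEquiv (h⁻¹ * k) := by
      rw [map_mul, map_inv]; group
    rw [this]
    exact (f.mem_iff _).2 hk)
  invFun := Quotient.map' (fun h => f.a.toMulEquiv.symm (f.g⁻¹ * h)) (by
    intro h k hk
    rw [QuotientGroup.leftRel_apply] at hk ⊢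
    rw [← f.mem_iff]
    have : f.a.toMulEquiv ((f.a.toMulEquiv.symm (f.g⁻¹ * h))⁻¹ *
        f.a.toMulEquiv.symm (f.g⁻¹ * k)) = h⁻¹ * k := by
      rw [map_mul, map_inv, MulEquiv.apply_symm_apply, MulEquiv.apply_symm_apply]; group
    rw [this]
    exact hk)
  left_inv := by
    rintro ⟨h⟩
    exact congrArg (Quotient.mk'' : G → G ⧸ Λ) (by simp)
  right_inv := by
    rintro ⟨h⟩
    exact congrArg (Quotient.mk'' : G → G ⧸ Λ) (by simp)

/-- The differential `Df = Ad(g) ∘ D(a)ₑ` on the Lie algebra. -/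
def D (f : Aff E Λ) : Module.End ℝ (GroupLieAlgebra 𝓘(ℝ, E) G) :=
  ((Ad f.g).comp (diffOne f.a.toMulEquiv.toMonoidHom)).toLinearMap

end Aff

instance [FiniteDimensional ℝ E] : FiniteDimensional ℝ (GroupLieAlgebra 𝓘(ℝ, E) G) :=
  inferInstanceAs (FiniteDimensional ℝ E)

/-- The norm of the model space, used as a norm on the Lie algebra. -/
def lieNorm (v : GroupLieAlgebra 𝓘(ℝ, E) G) : ℝ := @norm E _ v

/-- A finite family `g₁, …, g_l` of affine transformations is essential for `f₀` if for some
`η > 0`, `max_k ‖P^min (Dg_k) v‖ > η ‖v‖` for all nonzero `v` in the Lie algebra, where `P^min` is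
the projection onto `W^min` of `Df₀`. All norms on the Lie algebra give the same notion. -/
def IsEssential [FiniteDimensional ℝ E] {Λ : Subgroup G} (f₀ : Aff E Λ) {l : ℕ}
    (g : Fin l → Aff E Λ) : Prop :=
  ∃ η : ℝ, 0 < η ∧ ∀ v : GroupLieAlgebra 𝓘(ℝ, E) G, v ≠ 0 →
    ∃ k, η * lieNorm v < lieNorm (RealSpectral.Pmin f₀.D ((g k).D v))

/-- `h = exp v` for the Lie exponential map: `h = γ(1)` for a one-parameter subgroup `γ` of `G`
with `γ'(0) = v`. The tangent space at `γ 0 = 1` is identified with the Lie algebra. -/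
def IsLieExp (v : GroupLieAlgebra 𝓘(ℝ, E) G) (h : G) : Prop :=
  ∃ γ : ℝ → G, γ 0 = 1 ∧ (∀ s t, γ (s + t) = γ s * γ t) ∧
    HasMFDerivAt 𝓘(ℝ, ℝ) 𝓘(ℝ, E) γ 0
      (ContinuousLinearMap.toSpanSingleton ℝ (v : E) : ℝ →L[ℝ] E) ∧
    γ 1 = h

/-- The fast stable leaf `exp(W^min) x` of the affine transformation `f₀` through `x`. -/
def fastStableLeaf {Λ : Subgroup G} (f₀ : Aff E Λ) (x : G ⧸ Λ) : Set (G ⧸ Λ) :=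
  {y | ∃ v ∈ RealSpectral.Wmin f₀.D, ∃ h : G, IsLieExp v h ∧ y = h • x}

variable (E) in
/-- A smooth Riemannian metric on `G ⧸ Λ`, with `Λ` discrete. It is recorded through its pullback
under the local diffeomorphism `G → G ⧸ Λ`, that is, as a smooth Riemannian metric on `G`
invariant under the right translations by the elements of `Λ`. -/
structure QuotientMetric [LieGroup 𝓘(ℝ, E) ∞ G] (Λ : Subgroup G) where
  metric : Bundle.ContMDiffRiemannianMetric 𝓘(ℝ, E) ∞ E
    (fun x : G => TangentSpace 𝓘(ℝ, E) x)
  invariant : ∀ γ ∈ Λ, ∀ (x : G) (v w : TangentSpace 𝓘(ℝ, E) x),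
    metric.inner (x * γ) (mfderiv 𝓘(ℝ, E) 𝓘(ℝ, E) (fun z : G => z * γ) x v)
      (mfderiv 𝓘(ℝ, E) 𝓘(ℝ, E) (fun z : G => z * γ) x w) = metric.inner x v w

/-- The Riemannian distance on `G ⧸ Λ`. A `C¹` path from `x` to `y` in `G ⧸ Λ` lifts to a path of
the same length between some lifts of `x` and `y` to `G`, so the infimum of the lengths of such
paths is the infimum over the lifts of the Riemannian distances in `G`. -/
def QuotientMetric.dist [LieGroup 𝓘(ℝ, E) ∞ G] {Λ : Subgroup G} (m : QuotientMetric E Λ)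
    (x y : G ⧸ Λ) : ℝ :=
  letI : Bundle.RiemannianBundle (fun x : G => TangentSpace 𝓘(ℝ, E) x) :=
    ⟨m.metric.toRiemannianMetric⟩
  (⨅ (g : G) (h : G) (_ : (g : G ⧸ Λ) = x) (_ : (h : G ⧸ Λ) = y),
    Manifold.riemannianEDist 𝓘(ℝ, E) g h).toReal

end

end HomogeneousSpace

end

/-!
The points near `x` in `X = G ⧸ Λ` are the points `exp v • x` with `v` small. An affine
transformation `f` satisfies `f (exp v • x) = exp (Df v) • f x`, so it acts on these displacements
`v` by the linear map `Df`, whatever the base point is. The proof has a geometric part, which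
transfers the statement to displacements, and a linear part.

*Geometry.* In the chart at `1` one-parameter subgroups solve an ordinary differential equation
whose right-hand side is close to the initial velocity, so `exp` is near `0` a Lipschitz
perturbation of the identity, and it is injective with an image of controlled size
(`exists_lieExp_bilipschitz`). Locally a Riemannian distance is comparable to the distance in a
chart; hence, near every point of `G`, the distance from `k` to `exp v * k` is comparable to `‖v‖`.
The metric is invariant under right translations by `Λ`, which commute with the displacements, so by
compactness of `X` the comparison is uniform (`exists_forall_displacementBound`). As `Λ` is
discrete, small displacements of a point of `X` are also unique at a uniform scale
(`exists_lieExp_smul_injOn`). Together this gives `QuotientMetric.exists_dist_estimates`.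

*Linear part.* Put `A = Df₀` and let `y = exp v • x` belong to the set attached to `x`. The
invariance condition says that the forward orbits of `x` and `y` stay close, so all the vectors
`A ^ m v` are small. Suppose that `v` is not in `W^min`. There are `α < β`, above the minimal
modulus and below all the other moduli of the eigenvalues, such that `‖A ^ (m + n) v‖` is eventually
at least a multiple of `β ^ n ‖A ^ m v‖`, while `A⁻ⁿ` expands the `W^min`-component at least like `α⁻ⁿ`
(`exists_gap_estimates`). As the family is essential, some `A⁻ⁿ Dg_k Aⁿ (A ^ m v)` has norm at least
a multiple of `(β / α) ^ n u`, where `u = ‖A ^ m v‖`. This vector is the displacement between the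
images of the `m`-th iterates under `f₀⁻ⁿ g_k f₀ⁿ`, so its norm is at most a multiple of
`ν ^ n u ^ ϑ`, as long as it is known to be small. If `m` is chosen so that `u` is almost maximal
along the orbit, smallness propagates from `n` to `n + 1`: passing from `n` to `n + 1` at time `m`
amounts to applying `A⁻¹` to the vector at `n` for time `m + 1`. So the bound holds as long as
`ν ^ n u ^ ϑ` stays below a constant. With `ν = (β / α) ^ (1 / (q + 1))` and `q` large with respect
to `ϑ⁻¹`, the two bounds at the last such `n` force `u` to be bounded below by a constant
(`le_of_forall_pow_mul_le`), which is absurd when the sets are small. This is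
`RealSpectral.exists_rate_forall_eq_displacement`.
-/

/-! ### Growth rates on the spectral subspaces -/

noncomputable section

open scoped Manifold ContDiff TensorProduct Bundle

namespace RealSpectral

/-- A linear functional grows along the orbit of a generalized eigenvector of eigenvalue `μ` at a
rate slower than any `α > |μ|`. -/
lemma exists_bound_functional_of_pow_apply_eq_zero {W : Type*} [AddCommGroup W] [Module ℂ W]
    (T : Module.End ℂ W) (L : W →ₗ[ℂ] ℂ) {μ : ℂ} {α : ℝ} (hμ : ‖μ‖ < α) (k : ℕ) (z : W)
    (hz : ((T - μ • 1) ^ k) z = 0) : ∃ C : ℝ, ∀ n : ℕ, ‖L ((T ^ n) z)‖ ≤ C * α ^ n := by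
  have hα : 0 < α := (norm_nonneg μ).trans_lt hμ
  induction k generalizing z with
  | zero =>
    refine ⟨0, fun n => ?_⟩
    have : z = 0 := by simpa using hz
    simp [this]
  | succ k ih =>
    rw [pow_succ, Module.End.mul_apply] at hz
    obtain ⟨C, hC⟩ := ih _ hz
    refine ⟨max ‖L z‖ (C / (α - ‖μ‖)), fun n => ?_⟩
    set D := max ‖L z‖ (C / (α - ‖μ‖))
    induction n with
    | zero => simp [D]
    | succ n hn =>
      have h1 : (T ^ (n + 1)) z = μ • (T ^ n) z + (T ^ n) ((T - μ • 1) z) := by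
        rw [pow_succ, Module.End.mul_apply]
        simp
      have hD : C ≤ D * (α - ‖μ‖) := by
        rw [← div_le_iff₀ (by linarith)]
        exact le_max_right _ _
      have hp : 0 < α ^ n := pow_pos hα n
      rw [h1, map_add, map_smul, smul_eq_mul]
      calc ‖μ * L ((T ^ n) z) + L ((T ^ n) ((T - μ • 1) z))‖
          ≤ ‖μ‖ * ‖L ((T ^ n) z)‖ + ‖L ((T ^ n) ((T - μ • 1) z))‖ := by
            rw [← norm_mul]; exact norm_add_le _ _
        _ ≤ ‖μ‖ * (D * α ^ n) + D * (α - ‖μ‖) * α ^ n := by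
            gcongr
            exact (hC n).trans (by gcongr)
        _ = D * α ^ (n + 1) := by ring

variable {V : Type*} [NormedAddCommGroup V] [NormedSpace ℝ V]

lemma cx_pow_one_tmul (T : Module.End ℝ V) (n : ℕ) (v : V) :
    ((cx T) ^ n) ((1 : ℂ) ⊗ₜ[ℝ] v) = (1 : ℂ) ⊗ₜ[ℝ] ((T ^ n) v) := by
  induction n generalizing v with
  | zero => simp
  | succ n ih =>
    rw [pow_succ, Module.End.mul_apply, pow_succ, Module.End.mul_apply, ← ih]
    simp [cx]

/-- Bounds for all complex functionals along the complex orbits give a uniform bound on the real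
sum of generalized eigenspaces; the uniformity is the Banach-Steinhaus theorem. -/
lemma exists_norm_pow_le_on_realSum [FiniteDimensional ℝ V] (A T : Module.End ℝ V) (S : Set ℂ)
    {α : ℝ} (hα : 0 < α)
    (h : ∀ μ ∈ S, ∀ z ∈ (cx A).maxGenEigenspace μ, ∀ L : (ℂ ⊗[ℝ] V) →ₗ[ℂ] ℂ,
      ∃ C : ℝ, ∀ n : ℕ, ‖L (((cx T) ^ n) z)‖ ≤ C * α ^ n) :
    ∃ C : ℝ, 0 < C ∧ ∀ v ∈ realSum A S, ∀ n : ℕ, ‖(T ^ n) v‖ ≤ C * α ^ n * ‖v‖ := by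
  have h1 : ∀ z ∈ cxSum A S, ∀ L : (ℂ ⊗[ℝ] V) →ₗ[ℂ] ℂ,
      ∃ C : ℝ, ∀ n : ℕ, ‖L (((cx T) ^ n) z)‖ ≤ C * α ^ n := by
    intro z hz L
    unfold cxSum at hz
    rw [iSup_subtype'] at hz
    induction hz using Submodule.iSup_induction' with
    | mem i x hx => exact h i.1 i.2 x hx L
    | zero => exact ⟨0, fun n => by simp⟩
    | add x y _ _ hx hy =>
      obtain ⟨C, hC⟩ := hx
      obtain ⟨D, hD⟩ := hy
      refine ⟨C + D, fun n => ?_⟩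
      rw [map_add, map_add, add_mul]
      exact (norm_add_le _ _).trans (add_le_add (hC n) (hD n))
  let b := Module.finBasis ℝ V
  have h2 : ∀ v ∈ realSum A S, ∃ C : ℝ, ∀ n : ℕ, ‖(T ^ n) v‖ ≤ C * α ^ n := by
    intro v hv
    choose C hC using fun i => h1 _ hv ((Algebra.TensorProduct.basis ℂ b).coord i)
    refine ⟨∑ i, C i * ‖b i‖, fun n => ?_⟩
    conv_lhs => rw [← b.sum_repr ((T ^ n) v)]
    refine (norm_sum_le _ _).trans ?_
    rw [Finset.sum_mul]
    refine Finset.sum_le_sum fun i _ => ?_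
    have hi := hC i n
    rw [TensorProduct.mk_apply, cx_pow_one_tmul, Module.Basis.coord_apply,
      Algebra.TensorProduct.basis_repr_tmul] at hi
    simp only [one_smul, Finsupp.mapRange_apply, Complex.coe_algebraMap, Complex.norm_real] at hi
    rw [norm_smul]
    nlinarith [norm_nonneg (b i)]
  let W := realSum A S
  have : CompleteSpace W := FiniteDimensional.complete ℝ W
  let g : ℕ → (W →L[ℝ] V) := fun n =>
    LinearMap.toContinuousLinearMap ((α ^ n)⁻¹ • ((T ^ n).comp W.subtype))
  have hg : ∀ n (w : W), g n w = (α ^ n)⁻¹ • (T ^ n) (w : V) := fun n w => rfl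
  obtain ⟨C, hC⟩ := banach_steinhaus (g := g) (by
    intro w
    obtain ⟨C, hC⟩ := h2 w w.2
    refine ⟨C, fun n => ?_⟩
    have hp : 0 < α ^ n := pow_pos hα n
    rw [hg, norm_smul, norm_inv, Real.norm_of_nonneg hp.le, inv_mul_le_iff₀ hp, mul_comm]
    exact hC n)
  refine ⟨max C 1, by positivity, fun v hv n => ?_⟩
  have hp : 0 < α ^ n := pow_pos hα n
  have h3 := (g n).le_of_opNorm_le (hC n) ⟨v, hv⟩
  rw [hg, norm_smul, norm_inv, Real.norm_of_nonneg hp.le, inv_mul_le_iff₀ hp] at h3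
  calc ‖(T ^ n) v‖ ≤ α ^ n * (C * ‖v‖) := h3
    _ ≤ α ^ n * (max C 1 * ‖v‖) := by gcongr; exact le_max_left _ _
    _ = max C 1 * α ^ n * ‖v‖ := by ring

/-- The moduli of the eigenvalues of an endomorphism are separated: those of minimal modulus lie
below some `α`, the others above some `β > α`. -/
lemma exists_spectral_gap [FiniteDimensional ℝ V] (A : Module.End ℝ V) : ∃ α β : ℝ, 0 < α ∧ α < β ∧
      (∀ μ ∈ minEigenvalues A, ‖μ‖ < α) ∧
      ∀ μ ∉ minEigenvalues A, (cx A).HasEigenvalue μ → β < ‖μ‖ := by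
  have hfin : {μ | (cx A).HasEigenvalue μ}.Finite := Module.End.finite_hasEigenvalue _
  rcases Set.eq_empty_or_nonempty (minEigenvalues A) with h0 | ⟨μ₀, hμ₀⟩
  · refine ⟨1, 2, one_pos, one_lt_two, by simp [h0], fun μ _ hμ => ?_⟩
    obtain ⟨μ', h', hmin⟩ := Set.exists_min_image _ (fun μ : ℂ => ‖μ‖) hfin ⟨μ, hμ⟩
    have : μ' ∈ minEigenvalues A := ⟨h', hmin⟩
    simp [h0] at this
  · have hlt : ∀ μ ∉ minEigenvalues A, (cx A).HasEigenvalue μ → ‖μ₀‖ < ‖μ‖ := by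
      intro μ hμ he
      by_contra hle
      exact hμ ⟨he, fun μ' h' => (not_lt.1 hle).trans (hμ₀.2 μ' h')⟩
    obtain ⟨γ, hγ, hγ'⟩ : ∃ γ : ℝ, ‖μ₀‖ < γ ∧
        ∀ μ ∉ minEigenvalues A, (cx A).HasEigenvalue μ → γ ≤ ‖μ‖ := by
      rcases Set.eq_empty_or_nonempty {μ | (cx A).HasEigenvalue μ ∧ μ ∉ minEigenvalues A}
        with h1 | h1
      · refine ⟨‖μ₀‖ + 1, by linarith, fun μ h2 h3 => ?_⟩
        have : μ ∈ {μ | (cx A).HasEigenvalue μ ∧ μ ∉ minEigenvalues A} := ⟨h3, h2⟩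
        simp [h1] at this
      · obtain ⟨μ', h', hmin⟩ := Set.exists_min_image _ (fun μ : ℂ => ‖μ‖)
          (hfin.subset fun μ h => h.1) h1
        exact ⟨‖μ'‖, hlt μ' h'.2 h'.1, fun μ h2 h3 => hmin μ ⟨h3, h2⟩⟩
    obtain ⟨β, hβ, hβ'⟩ := exists_between hγ
    obtain ⟨α, hα, hα'⟩ := exists_between hβ
    refine ⟨α, β, (norm_nonneg _).trans_lt hα, hα', fun μ hμ => (hμ.2 _ hμ₀.1).trans_lt hα,
      fun μ h2 h3 => hβ'.trans_le (hγ' μ h2 h3)⟩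

/-- On `W^min` the powers of `A` grow at most like `αⁿ`, on the complementary sum of generalized
eigenspaces at least like `βⁿ`, with `α < β`. -/
lemma exists_growth_rates [FiniteDimensional ℝ V] (A Ai : Module.End ℝ V)
    (h1 : Ai * A = 1) (h2 : A * Ai = 1) : ∃ α β C : ℝ, 0 < α ∧ α < β ∧ 0 < C ∧
      (∀ v ∈ Wmin A, ∀ n : ℕ, ‖(A ^ n) v‖ ≤ C * α ^ n * ‖v‖) ∧
      ∀ v ∈ Wrest A, ∀ n : ℕ, β ^ n * ‖v‖ ≤ C * ‖(A ^ n) v‖ := by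
  obtain ⟨α, β, hα, hαβ, hmin, hrest⟩ := exists_spectral_gap A
  have hβ : 0 < β := hα.trans hαβ
  obtain ⟨C, hC, hC'⟩ := exists_norm_pow_le_on_realSum A A (minEigenvalues A) hα (by
    intro μ hμ z hz L
    obtain ⟨k, hk⟩ := (Module.End.mem_maxGenEigenspace _ _ _).1 hz
    exact exists_bound_functional_of_pow_apply_eq_zero _ L (hmin μ hμ) k z hk)
  have hcomm : ∀ μ : ℂ, μ ≠ 0 →
      cx Ai - μ⁻¹ • 1 = (-μ⁻¹) • (cx Ai * (cx A - μ • 1)) := by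
    intro μ hμ
    have : cx Ai * cx A = 1 := by
      rw [cx, cx, ← LinearMap.baseChange_mul, h1, LinearMap.baseChange_one]
    rw [mul_sub, this, mul_smul_comm, mul_one, smul_sub, smul_smul, neg_mul, inv_mul_cancel₀ hμ]
    simp only [neg_smul, one_smul]
    abel
  obtain ⟨D, hD, hD'⟩ := exists_norm_pow_le_on_realSum A Ai (minEigenvalues A)ᶜ
    (inv_pos.2 hβ) (by
    intro μ hμ z hz L
    by_cases he : (cx A).HasEigenvalue μ
    · have hμβ := hrest μ hμ he
      have hμ0 : μ ≠ 0 := norm_pos_iff.1 (hβ.trans hμβ)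
      obtain ⟨k, hk⟩ := (Module.End.mem_maxGenEigenspace _ _ _).1 hz
      refine exists_bound_functional_of_pow_apply_eq_zero _ L (μ := μ⁻¹) ?_ k z ?_
      · rw [norm_inv]
        exact inv_strictAnti₀ hβ hμβ
      · have hc : Commute (cx Ai) (cx A - μ • 1) := by
          have : Commute (cx Ai) (cx A) := by
            rw [Commute, SemiconjBy, cx, cx, ← LinearMap.baseChange_mul,
              ← LinearMap.baseChange_mul, h1, h2]
          exact this.sub_right ((Commute.one_right _).smul_right μ)
        rw [hcomm μ hμ0, smul_pow, hc.mul_pow, LinearMap.smul_apply, Module.End.mul_apply, hk]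
        simp
    · have hbot : (cx A).maxGenEigenspace μ = ⊥ := by
        by_contra hne
        apply he
        exact Module.End.HasUnifEigenvalue.lt (k := ⊤) (by simp) hne
      rw [hbot, Submodule.mem_bot] at hz
      exact ⟨0, fun n => by simp [hz]⟩)
  refine ⟨α, β, max C D, hα, hαβ, by positivity, fun v hv n => ?_, fun v hv n => ?_⟩
  · refine (hC' v hv n).trans ?_
    gcongr
    exact le_max_left _ _
  · have hAn : ∀ n : ℕ, (Ai ^ n) ((A ^ n) v) = v := by
      intro n
      have : Commute Ai A := by rw [Commute, SemiconjBy, h1, h2]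
      rw [← Module.End.mul_apply, ← this.mul_pow, h1]
      simp
    have hmem : ∀ n : ℕ, (A ^ n) v ∈ Wrest A := by
      intro n
      induction n with
      | zero => simpa using hv
      | succ n ih =>
        rw [pow_succ', Module.End.mul_apply]
        exact realSum_mapsTo A _ _ ih
    have := hD' _ (hmem n) n
    rw [hAn, inv_pow] at this
    have hp : 0 < β ^ n := pow_pos hβ n
    calc β ^ n * ‖v‖ ≤ β ^ n * (D * (β ^ n)⁻¹ * ‖(A ^ n) v‖) := by gcongr
      _ = D * ‖(A ^ n) v‖ := by field_simp
      _ ≤ max C D * ‖(A ^ n) v‖ := by gcongr; exact le_max_right _ _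

lemma Pmin_comm [FiniteDimensional ℝ V] (A : Module.End ℝ V) (v : V) :
    Pmin A (A v) = A (Pmin A v) := by
  have hc := isCompl_Wmin A
  obtain ⟨p, hp, q, hq, rfl⟩ := Submodule.mem_sup.1 (show v ∈ Wmin A ⊔ Wrest A by
    rw [hc.sup_eq_top]; trivial)
  have hl : ∀ x ∈ Wmin A, Pmin A x = x := fun x hx =>
    Submodule.projection_apply_left hc ⟨x, hx⟩
  have hr : ∀ x ∈ Wrest A, Pmin A x = 0 := fun x hx =>
    (Submodule.projection_apply_eq_zero_iff hc).2 hx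
  rw [map_add, map_add, map_add, hl p hp, hr q hq, hl _ (realSum_mapsTo A _ p hp),
    hr _ (realSum_mapsTo A _ q hq)]
  simp

end RealSpectral

end

noncomputable section

open scoped Manifold ContDiff TensorProduct Bundle

namespace RealSpectral

variable {V : Type*} [NormedAddCommGroup V] [NormedSpace ℝ V]

lemma Pmin_mem [FiniteDimensional ℝ V] (A : Module.End ℝ V) (v : V) : Pmin A v ∈ Wmin A :=
  Submodule.projection_apply_mem (isCompl_Wmin A) v

lemma sub_Pmin_mem [FiniteDimensional ℝ V] (A : Module.End ℝ V) (v : V) :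
    v - Pmin A v ∈ Wrest A := by
  refine (Submodule.projection_apply_eq_zero_iff (isCompl_Wmin A)).1 ?_
  rw [map_sub, sub_eq_zero]
  exact (Submodule.projection_apply_left (isCompl_Wmin A) ⟨_, Pmin_mem A v⟩).symm

lemma Pmin_pow_comm [FiniteDimensional ℝ V] (A : Module.End ℝ V) (n : ℕ) (v : V) :
    Pmin A ((A ^ n) v) = (A ^ n) (Pmin A v) := by
  induction n generalizing v with
  | zero => simp
  | succ n ih => rw [pow_succ, Module.End.mul_apply, Module.End.mul_apply, ih, Pmin_comm]

/-- Two consequences of the spectral gap. Backward iterates are bounded below on the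
`W^min`-component at rate `α⁻ⁿ`, and the forward orbit of a vector outside `W^min` is eventually
dominated by its component in the other generalized eigenspaces, hence grows at least at rate
`β > α`. -/
lemma exists_gap_estimates [FiniteDimensional ℝ V] (A Ai : Module.End ℝ V)
    (h1 : Ai * A = 1) (h2 : A * Ai = 1) : ∃ α β c : ℝ, 0 < α ∧ α < β ∧ 0 < c ∧
      (∀ z n, c * ‖Pmin A z‖ ≤ α ^ n * ‖(Ai ^ n) z‖) ∧
      ∀ v ∉ Wmin A, ∃ m₀ : ℕ, ∀ m ≥ m₀, ∀ n,
        c * β ^ n * ‖(A ^ m) v‖ ≤ ‖(A ^ (m + n)) v‖ := by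
  obtain ⟨α, β, C, hα, hαβ, hC, hW, hR⟩ := exists_growth_rates A Ai h1 h2
  have hβ := hα.trans hαβ
  let P : V →L[ℝ] V := LinearMap.toContinuousLinearMap (Pmin A)
  have hP : ∀ v, ‖Pmin A v‖ ≤ ‖P‖ * ‖v‖ := fun v => P.le_opNorm v
  let Q : V →L[ℝ] V := ContinuousLinearMap.id ℝ V - P
  have hQ : ∀ v, ‖v - Pmin A v‖ ≤ ‖Q‖ * ‖v‖ := fun v => Q.le_opNorm v
  have hcomm : Commute A Ai := by rw [Commute, SemiconjBy, h1, h2]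
  have hinv : ∀ n z, (A ^ n) ((Ai ^ n) z) = z := fun n z => by
    rw [← Module.End.mul_apply, ← hcomm.mul_pow, h2]; simp
  set c₁ := (C * (‖P‖ + 1))⁻¹
  set c₂ := (2 * (C * (‖Q‖ + 1)))⁻¹
  have hc₁ : 0 < c₁ := by positivity
  have hc₂ : 0 < c₂ := by positivity
  refine ⟨α, β, min c₁ c₂, hα, hαβ, lt_min hc₁ hc₂, fun z n => ?_, fun v hv => ?_⟩
  · have e1 : ‖Pmin A z‖ ≤ C * α ^ n * (‖P‖ * ‖(Ai ^ n) z‖) := by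
      conv_lhs => rw [← hinv n z, Pmin_pow_comm]
      refine (hW _ (Pmin_mem A _) n).trans ?_
      gcongr
      exact hP _
    calc min c₁ c₂ * ‖Pmin A z‖ ≤ c₁ * (C * α ^ n * (‖P‖ * ‖(Ai ^ n) z‖)) := by
          gcongr
          exact min_le_left _ _
      _ ≤ c₁ * (C * α ^ n * ((‖P‖ + 1) * ‖(Ai ^ n) z‖)) := by gcongr; linarith
      _ = α ^ n * ‖(Ai ^ n) z‖ := by simp only [c₁]; field_simp
  · set p := Pmin A v
    set q := v - p
    have hq : q ∈ Wrest A := sub_Pmin_mem A v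
    have hp : p ∈ Wmin A := Pmin_mem A v
    have hq0 : 0 < ‖q‖ := norm_pos_iff.2 fun h => hv (by
      have : v = p := sub_eq_zero.1 h
      rw [this]; exact hp)
    have hvs : v = p + q := by simp [q]
    have hPq : ∀ n, (A ^ n) v - Pmin A ((A ^ n) v) = (A ^ n) q := fun n => by
      rw [Pmin_pow_comm, ← map_sub]
    -- from some time on the component of the orbit in `W^min` is the smaller one
    obtain ⟨m₀, hm₀⟩ : ∃ m₀ : ℕ, ∀ m ≥ m₀, ‖(A ^ m) p‖ ≤ ‖(A ^ m) q‖ := by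
      have hlim : Filter.Tendsto (fun m : ℕ => C * (C * ‖p‖) * (α / β) ^ m) Filter.atTop
          (nhds (C * (C * ‖p‖) * 0)) :=
        (tendsto_pow_atTop_nhds_zero_of_lt_one (by positivity)
          ((div_lt_one hβ).2 hαβ)).const_mul _
      rw [mul_zero] at hlim
      obtain ⟨m₀, hm₀⟩ := Filter.eventually_atTop.1 (hlim.eventually_lt_const hq0)
      refine ⟨m₀, fun m hm => ?_⟩
      have e1 := hm₀ m hm
      have e2 := hW p hp m
      have e3 := hR q hq m
      have hbm : 0 < β ^ m := pow_pos hβ m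
      rw [div_pow, ← mul_div_assoc, div_lt_iff₀ hbm] at e1
      have e4 : C * (C * α ^ m * ‖p‖) ≤ C * ‖(A ^ m) q‖ := by nlinarith
      exact e2.trans (le_of_mul_le_mul_left e4 hC)
    refine ⟨m₀, fun m hm n => ?_⟩
    have e1 : ‖(A ^ m) v‖ ≤ 2 * ‖(A ^ m) q‖ := by
      rw [hvs, map_add]
      refine (norm_add_le _ _).trans ?_
      linarith [hm₀ m hm]
    have hmem : (A ^ m) q ∈ Wrest A := by
      rw [← hPq]; exact sub_Pmin_mem A _
    have e2 := hR _ hmem n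
    rw [← Module.End.mul_apply, ← pow_add, add_comm n m, ← hPq (m + n)] at e2
    have e3 := hQ ((A ^ (m + n)) v)
    have hbn : 0 < β ^ n := pow_pos hβ n
    calc min c₁ c₂ * β ^ n * ‖(A ^ m) v‖ ≤ c₂ * β ^ n * (2 * ‖(A ^ m) q‖) := by
          gcongr
          exact min_le_right _ _
      _ = 2 * c₂ * (β ^ n * ‖(A ^ m) q‖) := by ring
      _ ≤ 2 * c₂ * (C * ((‖Q‖ + 1) * ‖(A ^ (m + n)) v‖)) := by
          refine mul_le_mul_of_nonneg_left (e2.trans ?_) (by positivity)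
          refine mul_le_mul_of_nonneg_left (e3.trans ?_) hC.le
          gcongr
          linarith
      _ = ‖(A ^ (m + n)) v‖ := by simp only [c₂]; field_simp

/-- The numerical contradiction behind the rigidity. The hypothesis compares growth of the
conjugated differences at rate `ν ^ (q + 1)` with the admitted rate `ν`, for all times up to the
largest `n` with `ν ^ n * u ^ ϑ ≤ R`; at that last time it bounds `u` from below. -/
lemma le_of_forall_pow_mul_le {ν u ϑ R K : ℝ} {q : ℕ} (hν : 1 < ν) (hu : 0 < u) (hu1 : u ≤ 1)
    (hR : 0 < R) (hK : 0 < K) (hq : 2 ≤ ϑ * (q + 1)) (huR : u ^ ϑ ≤ R)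
    (h : ∀ n : ℕ, ν ^ n * u ^ ϑ ≤ R → (ν ^ (q + 1)) ^ n * u ≤ K * ν ^ n * u ^ ϑ) :
    (R / ν) ^ q / K ≤ u := by
  have hν0 : 0 < ν := one_pos.trans hν
  set s := u ^ ϑ
  have hs : 0 < s := Real.rpow_pos_of_pos hu _
  obtain ⟨N, hN, hN'⟩ : ∃ N : ℕ, ν ^ N * s ≤ R ∧ R < ν ^ (N + 1) * s := by
    obtain ⟨n, hn, hn'⟩ := exists_nat_pow_near (x := R / s) (y := ν)
      ((one_le_div hs).2 huR) hν
    exact ⟨n, (le_div_iff₀ hs).1 hn, (div_lt_iff₀ hs).1 hn'⟩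
  have hp : 0 < ν ^ N := pow_pos hν0 N
  have h1 : (ν ^ N) ^ q * u ≤ K * s := by
    have := h N hN
    rw [← pow_mul, mul_comm (q + 1) N, pow_mul, pow_succ] at this
    refine le_of_mul_le_mul_left (a := ν ^ N) ?_ hp
    linarith
  have h2 : R / ν ≤ ν ^ N * s := by
    rw [div_le_iff₀ hν0]
    calc R ≤ ν ^ (N + 1) * s := hN'.le
      _ = ν ^ N * s * ν := by ring
  have h3 : s ^ (q + 1) ≤ u ^ 2 := by
    have : s ^ (q + 1) = u ^ (ϑ * (q + 1)) := by
      rw [Real.rpow_mul hu.le, ← Real.rpow_natCast]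
      push_cast
      rfl
    rw [this, ← Real.rpow_two]
    exact Real.rpow_le_rpow_of_exponent_ge hu hu1 hq
  rw [div_le_iff₀ hK]
  refine le_of_mul_le_mul_right (a := u) ?_ hu
  calc (R / ν) ^ q * u ≤ (ν ^ N * s) ^ q * u := by gcongr
    _ = s ^ q * ((ν ^ N) ^ q * u) := by ring
    _ ≤ s ^ q * (K * s) := by gcongr
    _ = K * s ^ (q + 1) := by ring
    _ ≤ K * u ^ 2 := by gcongr
    _ = u * K * u := by ring

end RealSpectral

end

/-! ### The rigidity of displacements -/

noncomputable section

open scoped Manifold ContDiff TensorProduct Bundle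

namespace RealSpectral

/-- A bounded sequence with positive terms has a term at least half as large as all later ones
beyond a given index. -/
lemma exists_two_mul_ge_tail {u : ℕ → ℝ} {b : ℝ} (hu : ∀ m, u m ≤ b) (m₀ : ℕ) (h0 : 0 < u m₀) :
    ∃ m ≥ m₀, ∀ j ≥ m₀, u j ≤ 2 * u m := by
  have hbdd : BddAbove (Set.range fun j => u (m₀ + j)) := ⟨b, by rintro _ ⟨j, rfl⟩; exact hu _⟩
  set s := ⨆ j, u (m₀ + j)
  have hs : 0 < s := h0.trans_le (le_ciSup hbdd 0)
  obtain ⟨j, hj⟩ := exists_lt_of_lt_ciSup (show s / 2 < s by linarith)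
  refine ⟨m₀ + j, Nat.le_add_right _ _, fun i hi => ?_⟩
  have := le_ciSup hbdd (i - m₀)
  simp only [Nat.add_sub_cancel' hi] at this
  change u i ≤ s at this
  linarith

variable {V : Type*} [NormedAddCommGroup V] [NormedSpace ℝ V]

/-- The rigidity in abstract form. The set `X` carries displacements `e v : X → X`, intertwined by
`f` and by the maps `g k` with linear maps `A` and `B k`, and a function `d` that is uniformly
comparable to the size of small displacements. -/
theorem exists_rate_forall_eq_displacement [FiniteDimensional ℝ V] (A Ai : Module.End ℝ V)
    (h1 : Ai * A = 1) (h2 : A * Ai = 1) {ϑ : ℝ} (hϑ : 0 < ϑ) :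
    ∃ ν : ℝ, 1 < ν ∧ ∀ {X : Type*} (f : Equiv.Perm X) (e : V → X → X) (d : X → X → ℝ) (C r : ℝ),
      0 < C → 0 < r → (∀ v x, f (e v x) = e (A v) (f x)) → (∀ x y, 0 ≤ d x y) →
      (∀ x v, ‖v‖ ≤ r → d x (e v x) ≤ C * ‖v‖) →
      (∀ x v, ‖v‖ ≤ r → ‖v‖ ≤ C * d x (e v x)) →
      (∀ x y, d x y < r → ∃ v, ‖v‖ ≤ C * d x y ∧ y = e v x) →
      ∀ a : ℝ, 0 < a → ∀ (l : ℕ) (g : Fin l → Equiv.Perm X) (B : Fin l → Module.End ℝ V),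
      (∀ k v x, g k (e v x) = e (B k v) (g k x)) →
      (∃ η : ℝ, 0 < η ∧ ∀ v, v ≠ 0 → ∃ k, η * ‖v‖ < ‖Pmin A (B k v)‖) →
      ∃ ε₀ : ℝ, 0 < ε₀ ∧ ∀ L : X → Set X, (∀ x, ∀ y ∈ L x, d x y < ε₀) →
        (∀ x, ∀ y ∈ L x, f y ∈ L (f x)) →
        (∀ x, ∀ y ∈ L x, ∀ (n : ℕ) (k : Fin l),
          d ((f ^ (-(n : ℤ)) * g k * f ^ n) x) ((f ^ (-(n : ℤ)) * g k * f ^ n) y)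
            ≤ a * ν ^ n * d x y ^ ϑ) →
        ∀ x, ∀ y ∈ L x, ∃ v ∈ Wmin A, y = e v x := by
  obtain ⟨α, β, c, hα, hαβ, hc, hback, hforw⟩ := exists_gap_estimates A Ai h1 h2
  obtain ⟨q, hq⟩ := exists_nat_ge (2 / ϑ)
  have hq' : 2 ≤ ϑ * (q + 1) := by
    rw [div_le_iff₀ hϑ] at hq
    nlinarith
  have hβα : 1 < β / α := (one_lt_div hα).2 hαβ
  -- so that the spectral gap beats the admitted growth `ν ^ n` with a power `q` to spare
  set ν : ℝ := (β / α) ^ ((((q + 1 : ℕ) : ℝ))⁻¹)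
  have hν : 1 < ν := Real.one_lt_rpow hβα (by positivity)
  have hνq : ν ^ (q + 1) = β / α :=
    Real.rpow_inv_natCast_pow (by positivity) (Nat.succ_ne_zero q)
  have hν0 : 0 < ν := one_pos.trans hν
  refine ⟨ν, hν, fun {X} f e d C r hC hr hfe hd hup hlow hex a ha l g B hge ⟨η, hη, hess⟩ => ?_⟩
  have hbd : ∀ T : Module.End ℝ V, ∃ M : ℝ, 0 ≤ M ∧ ∀ v, ‖T v‖ ≤ M * ‖v‖ := fun T =>
    ⟨_, norm_nonneg _, (LinearMap.toContinuousLinearMap T).le_opNorm⟩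
  obtain ⟨a₀, ha₀, hA⟩ := hbd A
  obtain ⟨b₀, hb₀, hAi⟩ := hbd Ai
  choose M hM0 hM using fun k => hbd (B k)
  set M₀ := ∑ k, M k
  have hM₀ : 0 ≤ M₀ := Finset.sum_nonneg fun k _ => hM0 k
  have hB : ∀ k v, ‖B k v‖ ≤ M₀ * ‖v‖ := fun k v => (hM k v).trans (by
    gcongr
    exact Finset.single_le_sum (fun i _ => hM0 i) (Finset.mem_univ k))
  set K := C * a * C ^ ϑ
  have hK : 0 < K := by positivity
  set R := r / ((b₀ + 1) * K * 2 ^ ϑ)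
  have hR : 0 < R := by positivity
  set K' := K / (c * c * η)
  have hK' : 0 < K' := by positivity
  obtain ⟨τ, hτ, hτr, hτA, hτB, hτ1, hτR, hτK⟩ : ∃ τ : ℝ, 0 < τ ∧ τ ≤ r ∧ (a₀ + 1) * τ ≤ r ∧
      (M₀ + 1) * τ ≤ r ∧ τ ≤ 1 ∧ τ ≤ R ^ ϑ⁻¹ ∧ 2 * τ ≤ (R / ν) ^ q / K' := by
    have hpos : 0 < (R / ν) ^ q / K' := by positivity
    have hpos' : 0 < R ^ ϑ⁻¹ := by positivity
    refine ⟨min (r / (a₀ + 1)) (min (r / (M₀ + 1)) (min 1 (min (R ^ ϑ⁻¹)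
      ((R / ν) ^ q / K' / 2)))), by positivity, ?_, ?_, ?_, ?_, ?_, ?_⟩
    · exact (min_le_left _ _).trans (div_le_self hr.le (by linarith))
    · rw [mul_comm, ← le_div_iff₀ (by positivity)]
      exact min_le_left _ _
    · rw [mul_comm, ← le_div_iff₀ (by positivity)]
      exact (min_le_right _ _).trans (min_le_left _ _)
    · exact (min_le_right _ _).trans ((min_le_right _ _).trans (min_le_left _ _))
    · exact (min_le_right _ _).trans ((min_le_right _ _).trans
        ((min_le_right _ _).trans (min_le_left _ _)))
    · rw [mul_comm, ← le_div_iff₀ two_pos]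
      exact (min_le_right _ _).trans ((min_le_right _ _).trans
        ((min_le_right _ _).trans (min_le_right _ _)))
  refine ⟨min r (τ / C), by positivity, fun L hL hLf hLg x y hy => ?_⟩
  obtain ⟨v, hv, hyv⟩ := hex x y ((hL x y hy).trans_le (min_le_left _ _))
  refine ⟨v, ?_, hyv⟩
  by_contra hvW
  -- the orbits of the two points stay close, and differ by the displacements `A ^ m v`
  have horb : ∀ m : ℕ, (f ^ m) y ∈ L ((f ^ m) x) ∧ (f ^ m) y = e ((A ^ m) v) ((f ^ m) x) := by
    intro m
    induction m with
    | zero => simpa using ⟨hy, hyv⟩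
    | succ m ih =>
      rw [pow_succ', Equiv.Perm.mul_apply, Equiv.Perm.mul_apply, pow_succ', Module.End.mul_apply]
      exact ⟨hLf _ _ ih.1, by rw [← hfe, ← ih.2]⟩
  set δ : ℕ → ℝ := fun m => d ((f ^ m) x) ((f ^ m) y)
  set u : ℕ → ℝ := fun m => ‖(A ^ m) v‖
  have hδ : ∀ m, C * δ m ≤ τ := fun m => by
    have := ((hL _ _ (horb m).1).trans_le (min_le_right _ _)).le
    rw [le_div_iff₀ hC] at this
    linarith
  have hu : ∀ m, u m ≤ C * δ m := by
    intro m
    induction m with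
    | zero => simpa [u, δ] using hv
    | succ m ih =>
      have e1 : u (m + 1) ≤ r := by
        simp only [u, pow_succ', Module.End.mul_apply]
        refine (hA _).trans (le_trans ?_ hτA)
        have := ih.trans (hδ m)
        change ‖(A ^ m) v‖ ≤ τ at this
        gcongr
        linarith
      have := hlow ((f ^ (m + 1)) x) _ e1
      rwa [← (horb (m + 1)).2] at this
  have huτ : ∀ m, u m ≤ τ := fun m => (hu m).trans (hδ m)
  have hδu : ∀ m, δ m ≤ C * u m := fun m => by
    have := hup ((f ^ m) x) _ ((huτ m).trans hτr)
    rwa [← (horb m).2] at this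
  obtain ⟨m₀, hm₀⟩ := hforw v hvW
  have hupos : ∀ m, 0 < u m := fun m => by
    refine norm_pos_iff.2 fun h => hvW ?_
    have hcomm : Commute Ai A := by rw [Commute, SemiconjBy, h1, h2]
    have h3 : (Ai ^ m) ((A ^ m) v) = v := by
      rw [← Module.End.mul_apply, ← hcomm.mul_pow, h1]; simp
    rw [← h3, h, map_zero]
    exact zero_mem _
  obtain ⟨m, hm, hmax⟩ := exists_two_mul_ge_tail huτ m₀ (hupos m₀)
  -- the displacement between the images under the conjugates of `g k`
  have hconj : ∀ (n : ℕ) (k : Fin l) (w : V) (z : X),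
      (f ^ (-(n : ℤ)) * g k * f ^ n) (e w z)
        = e ((Ai ^ n) (B k ((A ^ n) w))) ((f ^ (-(n : ℤ)) * g k * f ^ n) z) := by
    intro n k w z
    have hfn : ∀ (n : ℕ) w z, (f ^ n) (e w z) = e ((A ^ n) w) ((f ^ n) z) := by
      intro n
      induction n with
      | zero => simp
      | succ n ih =>
        intro w z
        rw [pow_succ, Equiv.Perm.mul_apply, hfe, ih, pow_succ, Module.End.mul_apply,
          Equiv.Perm.mul_apply]
    have hcomm : Commute A Ai := by rw [Commute, SemiconjBy, h1, h2]
    have hA' : ∀ w, (A ^ n) ((Ai ^ n) w) = w := fun w => by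
      rw [← Module.End.mul_apply, ← hcomm.mul_pow, h2]; simp
    have hfn' : ∀ w z, (f ^ (-(n : ℤ))) (e w z) = e ((Ai ^ n) w) ((f ^ (-(n : ℤ))) z) := by
      intro w z
      rw [zpow_neg, zpow_natCast, Equiv.Perm.inv_eq_iff_eq, hfn, hA']
      simp
    simp only [Equiv.Perm.mul_apply]
    rw [hfn, hge, hfn']
  -- as long as the admitted bound is small, it bounds the displacements themselves
  have hdisp : ∀ n : ℕ, ν ^ n * u m ^ ϑ ≤ R → ∀ j ≥ m₀, ∀ k,
      ‖(Ai ^ n) (B k ((A ^ n) ((A ^ j) v)))‖ ≤ K * ν ^ n * u j ^ ϑ := by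
    have hstep : ∀ n j k, ‖(Ai ^ n) (B k ((A ^ n) ((A ^ j) v)))‖ ≤ r →
        ‖(Ai ^ n) (B k ((A ^ n) ((A ^ j) v)))‖ ≤ K * ν ^ n * u j ^ ϑ := by
      intro n j k hle
      have e1 := hlow ((f ^ (-(n : ℤ)) * g k * f ^ n) ((f ^ j) x)) _ hle
      rw [← hconj, ← (horb j).2] at e1
      refine e1.trans ?_
      have e2 : δ j ^ ϑ ≤ C ^ ϑ * u j ^ ϑ := by
        rw [← Real.mul_rpow hC.le (hupos j).le]
        exact Real.rpow_le_rpow (hd _ _) (hδu j) hϑ.le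
      calc C * d ((f ^ (-(n : ℤ)) * g k * f ^ n) ((f ^ j) x))
            ((f ^ (-(n : ℤ)) * g k * f ^ n) ((f ^ j) y))
          ≤ C * (a * ν ^ n * δ j ^ ϑ) := by
            gcongr
            exact hLg _ _ (horb j).1 n k
        _ ≤ C * (a * ν ^ n * (C ^ ϑ * u j ^ ϑ)) := by gcongr
        _ = K * ν ^ n * u j ^ ϑ := by simp only [K]; ring
    intro n
    induction n with
    | zero =>
      intro _ j _ k
      refine hstep 0 j k ?_
      simp only [pow_zero, Module.End.one_apply]
      refine (hB k _).trans (le_trans ?_ hτB)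
      have := huτ j
      change ‖(A ^ j) v‖ ≤ τ at this
      gcongr
      linarith
    | succ n ih =>
      intro hn j hj k
      refine hstep (n + 1) j k ?_
      have hn' : ν ^ n * u m ^ ϑ ≤ R := by
        refine le_trans ?_ hn
        have := hupos m
        gcongr
        · exact hν.le
        · omega
      have e1 := ih hn' (j + 1) (by omega) k
      have e2 : (Ai ^ (n + 1)) (B k ((A ^ (n + 1)) ((A ^ j) v)))
          = Ai ((Ai ^ n) (B k ((A ^ n) ((A ^ (j + 1)) v)))) := by
        rw [pow_succ' Ai, Module.End.mul_apply, ← Module.End.mul_apply (A ^ (n + 1)),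
          ← Module.End.mul_apply (A ^ n), ← pow_add, ← pow_add, add_assoc, add_comm 1 j]
      rw [e2]
      have e3 : u (j + 1) ^ ϑ ≤ 2 ^ ϑ * u m ^ ϑ := by
        rw [← Real.mul_rpow two_pos.le (hupos m).le]
        exact Real.rpow_le_rpow (hupos _).le (hmax _ (by omega)) hϑ.le
      have e4 : ν ^ n ≤ ν ^ (n + 1) := pow_le_pow_right₀ hν.le (Nat.le_succ n)
      have := hupos m
      calc ‖Ai ((Ai ^ n) (B k ((A ^ n) ((A ^ (j + 1)) v))))‖
          ≤ b₀ * (K * ν ^ n * u (j + 1) ^ ϑ) := (hAi _).trans (by gcongr)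
        _ ≤ (b₀ + 1) * (K * ν ^ (n + 1) * (2 ^ ϑ * u m ^ ϑ)) := by
            have := hupos (j + 1)
            gcongr
            linarith
        _ = (b₀ + 1) * K * 2 ^ ϑ * (ν ^ (n + 1) * u m ^ ϑ) := by ring
        _ ≤ (b₀ + 1) * K * 2 ^ ϑ * R := by gcongr
        _ = r := by simp only [R]; field_simp
  have hfinal : (R / ν) ^ q / K' ≤ u m := by
    refine le_of_forall_pow_mul_le (ϑ := ϑ) hν (hupos m) ((huτ m).trans hτ1) hR hK' hq' ?_ ?_
    · calc u m ^ ϑ ≤ (R ^ ϑ⁻¹) ^ ϑ :=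
            Real.rpow_le_rpow (hupos m).le ((huτ m).trans hτR) hϑ.le
        _ = R := Real.rpow_inv_rpow hR.le hϑ.ne'
    · intro n hn
      have hne : (A ^ n) ((A ^ m) v) ≠ 0 := by
        rw [← Module.End.mul_apply, ← pow_add]
        exact norm_pos_iff.1 (hupos (n + m))
      obtain ⟨k, hk⟩ := hess _ hne
      have e1 := hback (B k ((A ^ n) ((A ^ m) v))) n
      have e2 := hdisp n hn m hm k
      have e3 := hm₀ m hm n
      have e4 : ‖(A ^ n) ((A ^ m) v)‖ = ‖(A ^ (m + n)) v‖ := by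
        rw [← Module.End.mul_apply, ← pow_add, add_comm]
      rw [e4] at hk
      have hαn : 0 < α ^ n := pow_pos hα n
      have e5 : c * (η * (c * β ^ n * u m)) ≤ α ^ n * (K * ν ^ n * u m ^ ϑ) :=
        calc c * (η * (c * β ^ n * u m)) ≤ c * ‖Pmin A (B k ((A ^ n) ((A ^ m) v)))‖ := by
              gcongr
              exact (mul_le_mul_of_nonneg_left e3 hη.le).trans hk.le
          _ ≤ α ^ n * ‖(Ai ^ n) (B k ((A ^ n) ((A ^ m) v)))‖ := e1
          _ ≤ α ^ n * (K * ν ^ n * u m ^ ϑ) := by gcongr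
      rw [hνq, div_pow]
      simp only [K']
      rw [div_mul_eq_mul_div, div_mul_eq_mul_div, div_mul_eq_mul_div,
        div_le_div_iff₀ hαn (by positivity)]
      nlinarith [e5]
  linarith [huτ m]

end RealSpectral

end

/-! ### The Lie exponential map -/

noncomputable section

open scoped Manifold ContDiff TensorProduct Bundle Topology

namespace HomogeneousSpace

variable {E : Type*} [NormedAddCommGroup E] [NormedSpace ℝ E]
  {G : Type*} [TopologicalSpace G] [ChartedSpace E G] [Group G]

/-- `γ` is a one-parameter subgroup of `G` with initial velocity `v`. -/
structure IsOneParam (v : GroupLieAlgebra 𝓘(ℝ, E) G) (γ : ℝ → G) : Prop where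
  zero : γ 0 = 1
  add : ∀ s t, γ (s + t) = γ s * γ t
  deriv : HasMFDerivAt 𝓘(ℝ, ℝ) 𝓘(ℝ, E) γ 0
    (ContinuousLinearMap.toSpanSingleton ℝ (v : E) : ℝ →L[ℝ] E)

lemma isLieExp_iff {v : GroupLieAlgebra 𝓘(ℝ, E) G} {h : G} :
    IsLieExp v h ↔ ∃ γ, IsOneParam v γ ∧ γ 1 = h :=
  ⟨fun ⟨γ, h0, h1, h2, h3⟩ => ⟨γ, ⟨h0, h1, h2⟩, h3⟩,
    fun ⟨γ, ⟨h0, h1, h2⟩, h3⟩ => ⟨γ, h0, h1, h2, h3⟩⟩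

lemma diffOne_comp {φ ψ : G →* G} (hφ : MDifferentiableAt 𝓘(ℝ, E) 𝓘(ℝ, E) φ 1)
    (hψ : MDifferentiableAt 𝓘(ℝ, E) 𝓘(ℝ, E) ψ 1) :
    diffOne (E := E) (φ.comp ψ) = (diffOne φ).comp (diffOne ψ) := by
  let D : G → (E →L[ℝ] E) := fun x => mfderiv 𝓘(ℝ, E) 𝓘(ℝ, E) φ x
  have h : diffOne (E := E) (φ.comp ψ) = (D (ψ 1)).comp (diffOne (E := E) ψ : E →L[ℝ] E) :=
    mfderiv_comp (I' := 𝓘(ℝ, E)) (1 : G) (by rwa [map_one]) hψ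
  rw [map_one] at h
  exact h

section

variable [LieGroup 𝓘(ℝ, E) ∞ G]

lemma lieGroup_minSmoothness : LieGroup 𝓘(ℝ, E) (minSmoothness ℝ 3) G := by
  rw [minSmoothness_of_isRCLikeNormedField]
  infer_instance

lemma mdifferentiableAt_mul_left (g h : G) :
    MDifferentiableAt 𝓘(ℝ, E) 𝓘(ℝ, E) (fun x : G => g * x) h :=
  (contMDiff_mul_left (I := 𝓘(ℝ, E)) (n := ∞) (a := g)).mdifferentiable (by simp) h

lemma contMDiff_mulInvariantVectorField_one (v : GroupLieAlgebra 𝓘(ℝ, E) G) :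
    ContMDiff 𝓘(ℝ, E) 𝓘(ℝ, E).tangent 1
      (fun g : G => (⟨g, mulInvariantVectorField v g⟩ : TangentBundle 𝓘(ℝ, E) G)) := by
  have := lieGroup_minSmoothness (E := E) (G := G)
  refine (contMDiff_mulInvariantVectorField v).of_le ?_
  rw [minSmoothness_of_isRCLikeNormedField]
  norm_num

lemma mfderiv_mul_left_mulInvariantVectorField (v : GroupLieAlgebra 𝓘(ℝ, E) G) (g h : G) :
    mfderiv 𝓘(ℝ, E) 𝓘(ℝ, E) (fun x : G => g * x) h (mulInvariantVectorField v h)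
      = mulInvariantVectorField v (g * h) := by
  have h1 : (fun x : G => g * h * x) = (fun x => g * x) ∘ (fun x => h * x) := by
    ext x; simp [mul_assoc]
  let D : G → (E →L[ℝ] E) := fun x => mfderiv 𝓘(ℝ, E) 𝓘(ℝ, E) (fun y : G => g * y) x
  have h2 : mfderiv 𝓘(ℝ, E) 𝓘(ℝ, E) (fun x : G => g * h * x) 1
      = (D (h * 1)).comp (mfderiv 𝓘(ℝ, E) 𝓘(ℝ, E) (fun x : G => h * x) 1 : E →L[ℝ] E) := by
    rw [h1]
    exact mfderiv_comp (I' := 𝓘(ℝ, E)) _ (mdifferentiableAt_mul_left _ _)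
      (mdifferentiableAt_mul_left _ _)
  have hD : D (h * 1) = D h := by rw [mul_one]
  rw [hD] at h2
  exact (DFunLike.congr_fun h2 v).symm

/-- Left translates of integral curves of left-invariant fields are integral curves. -/
lemma isMIntegralCurveOn_mul_left {v : GroupLieAlgebra 𝓘(ℝ, E) G} {γ : ℝ → G} {s : Set ℝ}
    (hγ : IsMIntegralCurveOn γ (mulInvariantVectorField (I := 𝓘(ℝ, E)) v) s) (g : G) :
    IsMIntegralCurveOn (fun t => g * γ t) (mulInvariantVectorField (I := 𝓘(ℝ, E)) v) s := by
  intro t ht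
  have h1 := (mdifferentiableAt_mul_left (E := E) g (γ t)).hasMFDerivAt.comp_hasMFDerivWithinAt t
    (hγ t ht)
  refine h1.congr_mfderiv ?_
  refine ContinuousLinearMap.ext fun x => ?_
  have h2 := mfderiv_mul_left_mulInvariantVectorField v g (γ t)
  have h3 := (mfderiv 𝓘(ℝ, E) 𝓘(ℝ, E) (fun x : G => g * x) (γ t)).map_smul (x : ℝ)
    (mulInvariantVectorField v (γ t))
  rw [h2] at h3
  exact h3

lemma isMIntegralCurve_mul_left {v : GroupLieAlgebra 𝓘(ℝ, E) G} {γ : ℝ → G}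
    (hγ : IsMIntegralCurve γ (mulInvariantVectorField (I := 𝓘(ℝ, E)) v)) (g : G) :
    IsMIntegralCurve (fun t => g * γ t) (mulInvariantVectorField (I := 𝓘(ℝ, E)) v) := by
  rw [isMIntegralCurve_iff_isMIntegralCurveOn] at hγ ⊢
  exact isMIntegralCurveOn_mul_left hγ g

lemma IsOneParam.isMIntegralCurve {v : GroupLieAlgebra 𝓘(ℝ, E) G} {γ : ℝ → G}
    (h : IsOneParam v γ) :
    IsMIntegralCurve γ (mulInvariantVectorField (I := 𝓘(ℝ, E)) v) := by
  intro t
  have h1 : γ = (fun x => γ t * x) ∘ γ ∘ (fun s => s - t) := by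
    ext s
    simp [← h.add]
  have hs : HasMFDerivAt 𝓘(ℝ, ℝ) 𝓘(ℝ, ℝ) (fun s : ℝ => s - t) t (ContinuousLinearMap.id ℝ ℝ) :=
    ((hasFDerivAt_id t).sub_const t).hasMFDerivAt
  have h2 : HasMFDerivAt 𝓘(ℝ, ℝ) 𝓘(ℝ, E) γ (t - t)
      (ContinuousLinearMap.toSpanSingleton ℝ (v : E) : ℝ →L[ℝ] E) := by
    rw [sub_self]; exact h.deriv
  have h3 : HasMFDerivAt 𝓘(ℝ, E) 𝓘(ℝ, E) (fun x : G => γ t * x) (γ (t - t))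
      (mfderiv 𝓘(ℝ, E) 𝓘(ℝ, E) (fun x : G => γ t * x) 1 : E →L[ℝ] E) := by
    rw [sub_self, h.zero]
    exact (mdifferentiableAt_mul_left (E := E) (γ t) 1).hasMFDerivAt
  have h4 := h3.comp t (HasMFDerivAt.comp (f := fun s : ℝ => s - t) t h2 hs)
  rw [← h1] at h4
  refine h4.congr_mfderiv ?_
  refine ContinuousLinearMap.ext fun x => ?_
  exact (mfderiv 𝓘(ℝ, E) 𝓘(ℝ, E) (fun y : G => γ t * y) 1).map_smul (x : ℝ) v

section

variable [T2Space G]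

lemma isOneParam_of_isMIntegralCurve {v : GroupLieAlgebra 𝓘(ℝ, E) G} {γ : ℝ → G}
    (hγ : IsMIntegralCurve γ (mulInvariantVectorField (I := 𝓘(ℝ, E)) v)) (h0 : γ 0 = 1) :
    IsOneParam v γ where
  zero := h0
  add s t := by
    have h1 : IsMIntegralCurve (γ ∘ (· + s)) (mulInvariantVectorField (I := 𝓘(ℝ, E)) v) :=
      hγ.comp_add s
    have h2 := isMIntegralCurve_mul_left hγ (γ s)
    have := isMIntegralCurve_Ioo_eq_of_contMDiff_boundaryless (t₀ := 0)
      (contMDiff_mulInvariantVectorField_one v) h1 h2 (by simp [h0])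
    have h3 := congrFun this t
    simpa [add_comm] using h3
  deriv := by
    refine (hγ 0).congr_mfderiv ?_
    refine ContinuousLinearMap.ext fun x => ?_
    have h1 : (mulInvariantVectorField (I := 𝓘(ℝ, E)) v (γ 0) : E) = v := by
      rw [h0]
      have : (fun x : G => 1 * x) = id := by ext x; simp
      simp only [mulInvariantVectorField]
      rw [this]
      exact DFunLike.congr_fun (mfderiv_id (I := 𝓘(ℝ, E)) (x := (1 : G))) v
    change (x : ℝ) • (mulInvariantVectorField (I := 𝓘(ℝ, E)) v (γ 0) : E) = (x : ℝ) • (v : E)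
    rw [h1]
    rfl

lemma IsOneParam.unique {v : GroupLieAlgebra 𝓘(ℝ, E) G} {γ γ' : ℝ → G}
    (h : IsOneParam v γ) (h' : IsOneParam v γ') : γ = γ' :=
  isMIntegralCurve_Ioo_eq_of_contMDiff_boundaryless (t₀ := 0)
    (contMDiff_mulInvariantVectorField_one v) h.isMIntegralCurve h'.isMIntegralCurve
    (by rw [h.zero, h'.zero])

variable [CompleteSpace E]

/-- Left-invariant vector fields are complete: a local integral curve through `1`, translated, gives
integral curves of the same duration through all points. -/
lemma exists_isOneParam (v : GroupLieAlgebra 𝓘(ℝ, E) G) : ∃ γ : ℝ → G, IsOneParam v γ := by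
  have hv := contMDiff_mulInvariantVectorField_one v
  have : IsManifold 𝓘(ℝ, E) 1 G := inferInstance
  obtain ⟨γ, hγ0, hγ⟩ := exists_isMIntegralCurveAt_of_contMDiffAt_boundaryless (t₀ := 0)
    (hv.contMDiffAt (x := (1 : G)))
  obtain ⟨ε, hε, hγ⟩ := isMIntegralCurveAt_iff'.1 hγ
  rw [Real.ball_eq_Ioo, zero_sub, zero_add] at hγ
  obtain ⟨Γ, hΓ0, hΓ⟩ := exists_isMIntegralCurve_of_isMIntegralCurveOn hv hε
    (fun g => ⟨fun t => g * γ t, by simp [hγ0], isMIntegralCurveOn_mul_left hγ g⟩) 1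
  exact ⟨Γ, isOneParam_of_isMIntegralCurve hΓ hΓ0⟩

/-- The one-parameter subgroup with initial velocity `v`. -/
def oneParam (v : GroupLieAlgebra 𝓘(ℝ, E) G) : ℝ → G := (exists_isOneParam v).choose

lemma isOneParam_oneParam (v : GroupLieAlgebra 𝓘(ℝ, E) G) : IsOneParam v (oneParam v) :=
  (exists_isOneParam v).choose_spec

/-- The Lie exponential map. -/
def lieExp (v : GroupLieAlgebra 𝓘(ℝ, E) G) : G := oneParam v 1

lemma isLieExp_lieExp (v : GroupLieAlgebra 𝓘(ℝ, E) G) : IsLieExp v (lieExp v) :=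
  isLieExp_iff.2 ⟨_, isOneParam_oneParam v, rfl⟩

lemma IsLieExp.eq_lieExp {v : GroupLieAlgebra 𝓘(ℝ, E) G} {h : G} (hh : IsLieExp v h) :
    h = lieExp v := by
  obtain ⟨γ, hγ, rfl⟩ := isLieExp_iff.1 hh
  rw [hγ.unique (isOneParam_oneParam v)]
  rfl

/-- The exponential map is natural with respect to smooth endomorphisms. -/
lemma map_lieExp (φ : G →* G) (hφ : MDifferentiableAt 𝓘(ℝ, E) 𝓘(ℝ, E) φ 1)
    (v : GroupLieAlgebra 𝓘(ℝ, E) G) : φ (lieExp v) = lieExp (diffOne φ v) := by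
  refine IsLieExp.eq_lieExp (isLieExp_iff.2 ⟨φ ∘ oneParam v, ⟨?_, ?_, ?_⟩, rfl⟩)
  · simp [(isOneParam_oneParam v).zero]
  · intro s t
    simp [(isOneParam_oneParam v).add]
  · have h1 := (isOneParam_oneParam v).deriv
    have h2 : HasMFDerivAt 𝓘(ℝ, E) 𝓘(ℝ, E) φ (oneParam v 0)
        (mfderiv 𝓘(ℝ, E) 𝓘(ℝ, E) φ 1 : E →L[ℝ] E) := by
      rw [(isOneParam_oneParam v).zero]
      exact hφ.hasMFDerivAt
    refine (h2.comp 0 h1).congr_mfderiv ?_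
    refine ContinuousLinearMap.ext fun x => ?_
    exact (mfderiv 𝓘(ℝ, E) 𝓘(ℝ, E) φ 1 : E →L[ℝ] E).map_smul (x : ℝ) v

lemma lieExp_smul (v : E) (t : ℝ) :
    lieExp (G := G) (t • v : E) = oneParam (G := G) v t := by
  symm
  have h := isOneParam_oneParam (G := G) v
  refine IsLieExp.eq_lieExp (isLieExp_iff.2 ⟨fun s => oneParam (G := G) v (s * t),
    ⟨by simp [h.zero], fun s s' => by simp [add_mul, h.add], ?_⟩, by simp⟩)
  have hs : HasMFDerivAt 𝓘(ℝ, ℝ) 𝓘(ℝ, ℝ) (fun s : ℝ => s * t) 0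
      (ContinuousLinearMap.toSpanSingleton ℝ t) := by
    have h1 : HasFDerivAt (fun s : ℝ => s * t) (ContinuousLinearMap.toSpanSingleton ℝ t) 0 := by
      simpa using ((hasDerivAt_id (0 : ℝ)).mul_const t).hasFDerivAt
    exact h1.hasMFDerivAt
  have h2 : HasMFDerivAt 𝓘(ℝ, ℝ) 𝓘(ℝ, E) (oneParam (G := G) v) (0 * t)
      (ContinuousLinearMap.toSpanSingleton ℝ (v : E) : ℝ →L[ℝ] E) := by
    rw [zero_mul]; exact h.deriv
  refine (HasMFDerivAt.comp (f := fun s : ℝ => s * t) 0 h2 hs).congr_mfderiv ?_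
  refine ContinuousLinearMap.ext fun (x : ℝ) => ?_
  change (x * t) • v = x • t • v
  rw [mul_smul]

end

end

end HomogeneousSpace

end

/-! ### The exponential map in a chart -/

noncomputable section

open scoped Manifold ContDiff TensorProduct Bundle Topology

namespace HomogeneousSpace

section ODE

variable {E : Type*} [NormedAddCommGroup E] [NormedSpace ℝ E]

/-- Dependence of solutions of `c' = F(c) v` on the velocity `v`: if `F` is close to the identity,
the time-one value depends on `v` up to a small Lipschitz error like `v` itself. -/
lemma norm_sub_sub_le_of_hasDerivAt {F : E → E →L[ℝ] E} {S : Set E} {K : ℝ}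
    (hF : ∀ x ∈ S, ‖F x - 1‖ ≤ 1 / 4) (hFK : ∀ x ∈ S, ∀ y ∈ S, ‖F x - F y‖ ≤ K * ‖x - y‖)
    {v w : E} {c b : ℝ → E} (hv : K * ‖v‖ ≤ 1 / 16)
    (hc : ∀ t ∈ Set.Icc (0 : ℝ) 1, c t ∈ S ∧ HasDerivAt c (F (c t) v) t)
    (hb : ∀ t ∈ Set.Icc (0 : ℝ) 1, b t ∈ S ∧ HasDerivAt b (F (b t) w) t) (h0 : c 0 = b 0) :
    ‖c 1 - b 1 - (v - w)‖ ≤ 1 / 2 * ‖v - w‖ := by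
  set h : ℝ → E := fun t => c t - b t
  have hh0 : h 0 = 0 := by simp [h, h0]
  have hd : ∀ t ∈ Set.Icc (0 : ℝ) 1, HasDerivAt h (F (c t) v - F (b t) w) t := fun t ht =>
    (hc t ht).2.sub (hb t ht).2
  have hcont : ContinuousOn h (Set.Icc 0 1) := fun t ht => (hd t ht).continuousAt.continuousWithinAt
  obtain ⟨t₀, ht₀, hmax⟩ := isCompact_Icc.exists_isMaxOn
    (Set.nonempty_Icc.2 zero_le_one) hcont.norm
  set M := ‖h t₀‖
  have hM : ∀ t ∈ Set.Icc (0 : ℝ) 1, ‖h t‖ ≤ M := fun t ht => hmax ht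
  -- the velocities differ by the main term `v - w` up to a small error
  have herr : ∀ t ∈ Set.Icc (0 : ℝ) 1,
      ‖F (c t) v - F (b t) w - (v - w)‖ ≤ 1 / 16 * M + 1 / 4 * ‖v - w‖ := by
    intro t ht
    have e : F (c t) v - F (b t) w - (v - w) = (F (c t) - F (b t)) v + (F (b t) - 1) (v - w) := by
      simp only [sub_apply, one_apply_eq_self, map_sub]
      abel
    rw [e]
    refine (norm_add_le _ _).trans (add_le_add ?_ ?_)
    · calc ‖(F (c t) - F (b t)) v‖ ≤ (K * ‖h t‖) * ‖v‖ :=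
            (ContinuousLinearMap.le_opNorm _ _).trans
              (by gcongr; exact hFK _ (hc t ht).1 _ (hb t ht).1)
        _ = (K * ‖v‖) * ‖h t‖ := by ring
        _ ≤ 1 / 16 * M := by
            gcongr
            exact hM t ht
    · exact (ContinuousLinearMap.le_opNorm _ _).trans (by gcongr; exact hF _ (hb t ht).1)
  have hM' : M ≤ 4 * ‖v - w‖ := by
    have hder : ∀ t ∈ Set.Ico (0 : ℝ) 1,
        ‖F (c t) v - F (b t) w‖ ≤ 1 / 16 * M + 5 / 4 * ‖v - w‖ := by
      intro t ht
      have := norm_le_norm_sub_add (F (c t) v - F (b t) w) (v - w)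
      linarith [herr t ⟨ht.1, ht.2.le⟩]
    have := norm_image_sub_le_of_norm_deriv_le_segment' (f := h) (a := 0) (b := 1)
      (fun t ht => (hd t ht).hasDerivWithinAt) hder t₀ ht₀
    rw [hh0, sub_zero, sub_zero] at this
    have h2 : (1 / 16 * M + 5 / 4 * ‖v - w‖) * t₀ ≤ (1 / 16 * M + 5 / 4 * ‖v - w‖) * 1 := by
      gcongr
      exact ht₀.2
    change M ≤ _ at this
    nlinarith [norm_nonneg (v - w)]
  have hfin := norm_image_sub_le_of_norm_deriv_le_segment' (f := fun t => h t - t • (v - w))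
    (f' := fun t => F (c t) v - F (b t) w - (v - w)) (a := 0) (b := 1)
    (C := 1 / 16 * M + 1 / 4 * ‖v - w‖)
    (fun t ht => by
      have := (hd t ht).sub ((hasDerivAt_id t).smul_const (v - w))
      rw [one_smul] at this
      exact this.hasDerivWithinAt)
    (fun t ht => herr t ⟨ht.1, ht.2.le⟩) 1 ⟨zero_le_one, le_rfl⟩
  simp only [hh0, one_smul, zero_smul, sub_zero, mul_one] at hfin
  change ‖h 1 - (v - w)‖ ≤ _
  linarith

end ODE

variable {E : Type*} [NormedAddCommGroup E] [NormedSpace ℝ E]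
  {G : Type*} [TopologicalSpace G] [ChartedSpace E G] [Group G]

variable (E G) in
/-- The multiplication of `G` near `1`, read in the chart at `1`. -/
def chartMul (p : E × E) : E :=
  extChartAt 𝓘(ℝ, E) (1 : G) ((extChartAt 𝓘(ℝ, E) (1 : G)).symm p.1 *
    (extChartAt 𝓘(ℝ, E) (1 : G)).symm p.2)

variable (E G) in
/-- The left-invariant vector fields of `G` near `1`, read in the chart at `1`: the map sending a
vector to the value at `x` of the field it generates. -/
def chartField (x : E) : E →L[ℝ] E :=
  (fderiv ℝ (chartMul E G) (x, extChartAt 𝓘(ℝ, E) (1 : G) 1)).comp (.inr ℝ E E)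

/-- One-parameter subgroups solve the differential equation of `chartField`. -/
lemma IsOneParam.hasDerivAt_chart {v : E} {γ : ℝ → G}
    (h : IsOneParam (E := E) (G := G) v γ) {t : ℝ}
    (ht : γ t ∈ (extChartAt 𝓘(ℝ, E) (1 : G)).source)
    (hd : DifferentiableAt ℝ (chartMul E G)
      (extChartAt 𝓘(ℝ, E) (1 : G) (γ t), extChartAt 𝓘(ℝ, E) (1 : G) 1)) :
    HasDerivAt (fun s => extChartAt 𝓘(ℝ, E) (1 : G) (γ s))
      (chartField E G (extChartAt 𝓘(ℝ, E) (1 : G) (γ t)) v) t := by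
  set φ := extChartAt 𝓘(ℝ, E) (1 : G)
  have h0 : HasDerivAt (fun s => φ (γ s)) v 0 := by
    have h1 : HasFDerivWithinAt (fun s => φ (γ s))
        (ContinuousLinearMap.toSpanSingleton ℝ v : ℝ →L[ℝ] E) Set.univ (0 : ℝ) := by
      have h2 := h.deriv.2
      simp only [writtenInExtChartAt, h.zero, mfld_simps] at h2
      exact h2
    rw [hasFDerivWithinAt_univ] at h1
    simpa using h1.hasDerivAt
  have hshift : HasDerivAt (fun s => φ (γ (s - t))) v t := by
    have h2 : HasDerivAt (fun s => φ (γ s)) v (t - t) := by rwa [sub_self]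
    exact h2.comp_sub_const t t
  have hd' : HasFDerivAt (chartMul E G) (fderiv ℝ (chartMul E G) (φ (γ t), φ 1))
      (φ (γ t), φ (γ (t - t))) := by
    rw [sub_self, h.zero]
    exact hd.hasFDerivAt
  have h3 := hd'.comp_hasDerivAt t ((hasDerivAt_const t (φ (γ t))).prodMk hshift)
  refine h3.congr_of_eventuallyEq ?_
  have hcont : ContinuousAt (fun s => γ (s - t)) t := by
    have h4 : ContinuousAt γ (t - t) := by rw [sub_self]; exact h.deriv.continuousAt
    exact ContinuousAt.comp (f := fun s => s - t) h4 (by fun_prop)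
  have hsrc : ∀ᶠ s in 𝓝 t, γ (s - t) ∈ φ.source := by
    refine hcont.eventually_mem ?_
    simp only [sub_self, h.zero]
    exact extChartAt_source_mem_nhds (I := 𝓘(ℝ, E)) (1 : G)
  filter_upwards [hsrc] with s hs
  simp only [Function.comp_apply, chartMul]
  change φ (γ s) = φ (φ.symm (φ (γ t)) * φ.symm (φ (γ (s - t))))
  rw [φ.left_inv ht, φ.left_inv hs, ← h.add]
  congr 2
  ring

section

variable [LieGroup 𝓘(ℝ, E) ∞ G]

lemma contDiffAt_chartMul : ContDiffAt ℝ ∞ (chartMul E G)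
    (extChartAt 𝓘(ℝ, E) (1 : G) 1, extChartAt 𝓘(ℝ, E) (1 : G) 1) := by
  set φ := extChartAt 𝓘(ℝ, E) (1 : G)
  have hsymm : ContMDiffAt 𝓘(ℝ, E) 𝓘(ℝ, E) ∞ φ.symm (φ 1) := by
    have h := contMDiffOn_extChartAt_symm (I := 𝓘(ℝ, E)) (n := ∞) (1 : G)
    exact h.contMDiffAt (extChartAt_target_mem_nhds (I := 𝓘(ℝ, E)) (1 : G))
  have h1 : ContMDiffAt 𝓘(ℝ, E × E) 𝓘(ℝ, E) ∞ (fun p : E × E => φ.symm p.1) (φ 1, φ 1) :=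
    ContMDiffAt.comp (g := φ.symm) (f := Prod.fst) (φ 1, φ 1) hsymm contDiffAt_fst.contMDiffAt
  have h2 : ContMDiffAt 𝓘(ℝ, E × E) 𝓘(ℝ, E) ∞ (fun p : E × E => φ.symm p.2) (φ 1, φ 1) :=
    ContMDiffAt.comp (g := φ.symm) (f := Prod.snd) (φ 1, φ 1) hsymm contDiffAt_snd.contMDiffAt
  have h3 := h1.mul h2
  have h4 : ContMDiffAt 𝓘(ℝ, E) 𝓘(ℝ, E) ∞ φ (φ.symm (φ 1) * φ.symm (φ 1)) := by
    rw [extChartAt_to_inv, mul_one]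
    exact contMDiffAt_extChartAt
  exact (ContMDiffAt.comp (g := φ) (φ 1, φ 1) h4 h3).contDiffAt

lemma chartField_one :
    chartField E G (extChartAt 𝓘(ℝ, E) (1 : G) 1) = 1 := by
  set φ := extChartAt 𝓘(ℝ, E) (1 : G)
  have hd : HasFDerivAt (chartMul E G) (fderiv ℝ (chartMul E G) (φ 1, φ 1)) (φ 1, φ 1) :=
    ((contDiffAt_chartMul (E := E) (G := G)).differentiableAt (by simp)).hasFDerivAt
  have h1 : HasFDerivAt (fun u : E => chartMul E G (φ 1, u)) (chartField E G (φ 1)) (φ 1) := by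
    have : HasFDerivAt (fun u : E => (φ 1, u)) (ContinuousLinearMap.inr ℝ E E) (φ 1) :=
      hasFDerivAt_prodMk_right (φ 1) (φ 1)
    exact HasFDerivAt.comp (φ 1) hd this
  have h2 : (fun u : E => chartMul E G (φ 1, u)) =ᶠ[𝓝 (φ 1)] id := by
    filter_upwards [extChartAt_target_mem_nhds (I := 𝓘(ℝ, E)) (1 : G)] with u hu
    simp only [chartMul, id]
    rw [extChartAt_to_inv, one_mul]
    exact φ.right_inv hu
  exact h1.unique ((hasFDerivAt_id _).congr_of_eventuallyEq h2)

/-- A ball on which the chart and the invariant fields are under control. -/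
lemma exists_ball_chartField [CompleteSpace E] : ∃ ρ K : ℝ, 0 < ρ ∧ 0 ≤ K ∧
    Metric.closedBall (extChartAt 𝓘(ℝ, E) (1 : G) 1) ρ ⊆ (extChartAt 𝓘(ℝ, E) (1 : G)).target ∧
    ∀ x ∈ Metric.closedBall (extChartAt 𝓘(ℝ, E) (1 : G) 1) ρ,
      DifferentiableAt ℝ (chartMul E G) (x, extChartAt 𝓘(ℝ, E) (1 : G) 1) ∧
      ‖chartField E G x - 1‖ ≤ 1 / 4 ∧
      ∀ y ∈ Metric.closedBall (extChartAt 𝓘(ℝ, E) (1 : G) 1) ρ,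
        ‖chartField E G x - chartField E G y‖ ≤ K * ‖x - y‖ := by
  set φ := extChartAt 𝓘(ℝ, E) (1 : G)
  have hM := contDiffAt_chartMul (E := E) (G := G)
  have hpair : ContDiff ℝ 1 (fun x : E => (x, φ 1)) := by fun_prop
  have hF : ContDiffAt ℝ 1 (chartField E G) (φ 1) := by
    have h1 : ContDiffAt ℝ 1 (fderiv ℝ (chartMul E G)) (φ 1, φ 1) :=
      hM.fderiv_right (m := 1) (by rw [one_add_one_eq_two]; exact ENat.LEInfty.out)
    have h2 : ContDiffAt ℝ 1 (fun x : E => fderiv ℝ (chartMul E G) (x, φ 1)) (φ 1) :=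
      ContDiffAt.comp (g := fderiv ℝ (chartMul E G)) (φ 1) h1 hpair.contDiffAt
    exact h2.clm_comp contDiffAt_const
  obtain ⟨K, t, ht, hK⟩ := hF.exists_lipschitzOnWith
  have hev : ∀ᶠ x in 𝓝 (φ 1), x ∈ φ.target ∧ x ∈ t ∧
      DifferentiableAt ℝ (chartMul E G) (x, φ 1) ∧ ‖chartField E G x - 1‖ ≤ 1 / 4 := by
    refine Filter.Eventually.and (extChartAt_target_mem_nhds (I := 𝓘(ℝ, E)) (1 : G))
      (Filter.Eventually.and ht (Filter.Eventually.and ?_ ?_))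
    · have h1 : ∀ᶠ p in 𝓝 (φ 1, φ 1), DifferentiableAt ℝ (chartMul E G) p := by
        have := (hM.of_le (show (1 : WithTop ℕ∞) ≤ ∞ from mod_cast le_top)).eventually (by simp)
        exact this.mono fun p hp => hp.differentiableAt (by simp)
      exact (hpair.continuous.tendsto (φ 1)).eventually h1
    · have h1 : Filter.Tendsto (fun x => ‖chartField E G x - 1‖) (𝓝 (φ 1)) (𝓝 0) := by
        have := (hF.continuousAt.sub (continuousAt_const (y := (1 : E →L[ℝ] E)))).norm
        have h2 : chartField E G (φ 1) - 1 = 0 := by rw [chartField_one, sub_self]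
        simpa only [ContinuousAt, Pi.sub_apply, h2, norm_zero] using this
      exact (h1.eventually_lt_const (by norm_num : (0 : ℝ) < 1 / 4)).mono fun x hx => hx.le
  obtain ⟨ρ, hρ, hρ'⟩ := Metric.nhds_basis_closedBall.eventually_iff.1 hev
  refine ⟨ρ, K, hρ, K.2, fun x hx => (hρ' hx).1, fun x hx => ⟨(hρ' hx).2.2.1, (hρ' hx).2.2.2,
    fun y hy => ?_⟩⟩
  have := hK.dist_le_mul x (hρ' hx).2.1 y (hρ' hy).2.1
  simpa [dist_eq_norm] using this

end

end HomogeneousSpace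

end

noncomputable section

open scoped Manifold ContDiff TensorProduct Bundle Topology

namespace HomogeneousSpace

variable {E : Type*} [NormedAddCommGroup E] [NormedSpace ℝ E] [FiniteDimensional ℝ E]
  {G : Type*} [TopologicalSpace G] [T2Space G] [ChartedSpace E G] [Group G]
  [LieGroup 𝓘(ℝ, E) ∞ G]

/-- A one-parameter subgroup with small velocity stays in a small ball of the chart at `1` up to
time one: as long as it does, its chart velocity is bounded, so it cannot reach the boundary. -/
lemma IsOneParam.mem_ball {ρ : ℝ} (hρ : 0 < ρ)
    (hρt : Metric.closedBall (extChartAt 𝓘(ℝ, E) (1 : G) 1) ρ ⊆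
      (extChartAt 𝓘(ℝ, E) (1 : G)).target)
    (hρd : ∀ x ∈ Metric.closedBall (extChartAt 𝓘(ℝ, E) (1 : G) 1) ρ,
      DifferentiableAt ℝ (chartMul E G) (x, extChartAt 𝓘(ℝ, E) (1 : G) 1) ∧
      ‖chartField E G x - 1‖ ≤ 1 / 4)
    {v : E} {γ : ℝ → G} (h : IsOneParam (E := E) (G := G) v γ) (hv : ‖v‖ ≤ ρ / 4) :
    ∀ t ∈ Set.Icc (0 : ℝ) 1, γ t ∈ (extChartAt 𝓘(ℝ, E) (1 : G)).source ∧
      extChartAt 𝓘(ℝ, E) (1 : G) (γ t) ∈ Metric.closedBall (extChartAt 𝓘(ℝ, E) (1 : G) 1) ρ := by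
  set φ := extChartAt 𝓘(ℝ, E) (1 : G)
  have hcont : Continuous γ := continuous_iff_continuousAt.2 fun t =>
    (h.isMIntegralCurve t).continuousAt
  set U : Set G := φ.symm '' Metric.closedBall (φ 1) ρ
  have hU : IsClosed U := ((isCompact_closedBall _ _).image_of_continuousOn
    ((continuousOn_extChartAt_symm (I := 𝓘(ℝ, E)) (1 : G)).mono hρt)).isClosed
  have hUmem : ∀ x ∈ U, x ∈ φ.source ∧ φ x ∈ Metric.closedBall (φ 1) ρ := by
    rintro _ ⟨y, hy, rfl⟩
    exact ⟨φ.map_target (hρt hy), by rwa [φ.right_inv (hρt hy)]⟩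
  have hUnhds : ∀ x ∈ φ.source, φ x ∈ Metric.ball (φ 1) ρ → U ∈ 𝓝 x := by
    intro x hx hxb
    have hc : ContinuousAt φ x := by
      have := (continuousOn_extChartAt (I := 𝓘(ℝ, E)) (1 : G)).continuousAt
        ((isOpen_extChartAt_source (I := 𝓘(ℝ, E)) (1 : G)).mem_nhds hx)
      exact this
    filter_upwards [(isOpen_extChartAt_source (I := 𝓘(ℝ, E)) (1 : G)).mem_nhds hx,
      hc.preimage_mem_nhds (Metric.isOpen_ball.mem_nhds hxb)] with y hy hyb
    exact ⟨φ y, Metric.ball_subset_closedBall hyb, φ.left_inv hy⟩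
  have h0 : (0 : ℝ) ∈ γ ⁻¹' U := by
    refine ⟨φ 1, Metric.mem_closedBall_self hρ.le, ?_⟩
    rw [h.zero]
    exact extChartAt_to_inv (I := 𝓘(ℝ, E)) (1 : G)
  have hcl : IsClosed (γ ⁻¹' U ∩ Set.Icc 0 1) := (hU.preimage hcont).inter isClosed_Icc
  suffices hsub : Set.Icc 0 1 ⊆ γ ⁻¹' U from fun t ht => hUmem _ (hsub ht)
  apply hcl.Icc_subset_of_forall_mem_nhdsGT_of_Icc_subset h0
  rintro t ⟨ht0, ht1⟩ htsub
  have hd : ∀ s ∈ Set.Icc 0 t, HasDerivWithinAt (fun s => φ (γ s)) (chartField E G (φ (γ s)) v)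
      (Set.Icc 0 t) s := fun s hs =>
    (h.hasDerivAt_chart (hUmem _ (htsub hs)).1
      (hρd _ (hUmem _ (htsub hs)).2).1).hasDerivWithinAt
  have hbound : ∀ s ∈ Set.Ico 0 t, ‖chartField E G (φ (γ s)) v‖ ≤ 5 / 4 * (ρ / 4) := by
    intro s hs
    have h1 := (hρd _ (hUmem _ (htsub ⟨hs.1, hs.2.le⟩)).2).2
    have h2 : chartField E G (φ (γ s)) v = (chartField E G (φ (γ s)) - 1) v + v := by simp
    rw [h2]
    refine (norm_add_le _ _).trans ?_
    have h3 := ContinuousLinearMap.le_of_opNorm_le _ h1 v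
    linarith
  have hle := norm_image_sub_le_of_norm_deriv_le_segment' hd hbound t ⟨ht0, le_rfl⟩
  have hball : φ (γ t) ∈ Metric.ball (φ 1) ρ := by
    rw [Metric.mem_ball, dist_eq_norm]
    rw [h.zero] at hle
    refine hle.trans_lt ?_
    nlinarith
  exact hcont.continuousWithinAt (hUnhds _ (hUmem _ (htsub ⟨ht0, le_rfl⟩)).1 hball)

lemma lieExp_zero : lieExp (E := E) (0 : GroupLieAlgebra 𝓘(ℝ, E) G) = 1 := by
  have h := lieExp_smul (G := G) (0 : E) 0
  have h2 : oneParam (E := E) (G := G) (0 : E) 0 = 1 :=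
    (isOneParam_oneParam (E := E) (G := G) _).zero
  rw [smul_zero, h2] at h
  exact h

/-- Near `0` the exponential map, read in the chart at `1`, is a Lipschitz perturbation of the
identity. -/
lemma exists_lieExp_approximates : ∃ r : ℝ, 0 < r ∧
    (∀ v : E, ‖v‖ ≤ r → lieExp (G := G) v ∈ (extChartAt 𝓘(ℝ, E) (1 : G)).source) ∧
    ∀ v w : E, ‖v‖ ≤ r → ‖w‖ ≤ r →
      ‖extChartAt 𝓘(ℝ, E) (1 : G) (lieExp (G := G) v)
        - extChartAt 𝓘(ℝ, E) (1 : G) (lieExp (G := G) w) - (v - w)‖ ≤ 1 / 2 * ‖v - w‖ := by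
  obtain ⟨ρ, K, hρ, hK, hρt, hρd⟩ := exists_ball_chartField (E := E) (G := G)
  have hone : ∀ v : E, IsOneParam (E := E) (G := G) v (oneParam (G := G) v) :=
    fun v => isOneParam_oneParam v
  have hmem := fun (v : E) (hv : ‖v‖ ≤ ρ / 4) =>
    (hone v).mem_ball hρ hρt (fun x hx => ⟨(hρd x hx).1, (hρd x hx).2.1⟩) hv
  refine ⟨min (ρ / 4) (1 / (16 * (K + 1))), by positivity, fun v hv => ?_, fun v w hv hw => ?_⟩
  · exact (hmem v (hv.trans (min_le_left _ _)) 1 ⟨zero_le_one, le_rfl⟩).1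
  · have hmv := hmem v (hv.trans (min_le_left _ _))
    have hmw := hmem w (hw.trans (min_le_left _ _))
    refine norm_sub_sub_le_of_hasDerivAt (F := chartField E G) (K := K)
      (S := Metric.closedBall (extChartAt 𝓘(ℝ, E) (1 : G) 1) ρ)
      (c := fun t => extChartAt 𝓘(ℝ, E) (1 : G) (oneParam (G := G) v t))
      (b := fun t => extChartAt 𝓘(ℝ, E) (1 : G) (oneParam (G := G) w t))
      (fun x hx => (hρd x hx).2.1) (fun x hx y hy => (hρd x hx).2.2 y hy) ?_
      (fun t ht => ⟨(hmv t ht).2, (hone v).hasDerivAt_chart (hmv t ht).1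
        (hρd _ (hmv t ht).2).1⟩)
      (fun t ht => ⟨(hmw t ht).2, (hone w).hasDerivAt_chart (hmw t ht).1
        (hρd _ (hmw t ht).2).1⟩) ?_
    · have h1 := hv.trans (min_le_right _ _)
      rw [le_div_iff₀ (by positivity)] at h1
      nlinarith [norm_nonneg v]
    · simp only [(hone v).zero, (hone w).zero]

/-- The exponential map is a bi-Lipschitz bijection between neighbourhoods of `0` and `1`, with
respect to the chart at `1`. -/
lemma exists_lieExp_bilipschitz : ∃ r : ℝ, 0 < r ∧
    (∀ v : E, ‖v‖ ≤ r → lieExp (G := G) v ∈ (extChartAt 𝓘(ℝ, E) (1 : G)).source) ∧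
    (∀ v : E, ‖v‖ ≤ r → ‖extChartAt 𝓘(ℝ, E) (1 : G) (lieExp (G := G) v)
      - extChartAt 𝓘(ℝ, E) (1 : G) 1‖ ≤ 2 * ‖v‖) ∧
    (∀ v w : E, ‖v‖ ≤ r → ‖w‖ ≤ r → lieExp (G := G) v = lieExp (G := G) w → v = w) ∧
    ∀ h ∈ (extChartAt 𝓘(ℝ, E) (1 : G)).source,
      ‖extChartAt 𝓘(ℝ, E) (1 : G) h - extChartAt 𝓘(ℝ, E) (1 : G) 1‖ ≤ r / 2 →
      ∃ v : E, ‖v‖ ≤ 2 * ‖extChartAt 𝓘(ℝ, E) (1 : G) h - extChartAt 𝓘(ℝ, E) (1 : G) 1‖ ∧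
        h = lieExp (G := G) v := by
  obtain ⟨r, hr, hsrc, happ⟩ := exists_lieExp_approximates (E := E) (G := G)
  set φ := extChartAt 𝓘(ℝ, E) (1 : G)
  have h0 : lieExp (E := E) (G := G) (0 : E) = 1 := lieExp_zero
  have happ0 : ∀ v : E, ‖v‖ ≤ r → ‖φ (lieExp (G := G) v) - φ 1 - v‖ ≤ 1 / 2 * ‖v‖ := by
    intro v hv
    have := happ v 0 hv (by simpa using hr.le)
    rwa [h0, sub_zero] at this
  refine ⟨r, hr, hsrc, fun v hv => ?_, fun v w hv hw hvw => ?_, fun h hh hhr => ?_⟩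
  · have h1 := happ0 v hv
    have h2 := norm_le_norm_sub_add (φ (lieExp (G := G) v) - φ 1) v
    linarith [norm_nonneg v]
  · have h1 := happ v w hv hw
    rw [hvw, sub_self, zero_sub, norm_neg] at h1
    have : ‖v - w‖ = 0 := le_antisymm (by linarith) (norm_nonneg _)
    exact sub_eq_zero.1 (norm_eq_zero.1 this)
  · have hA : ApproximatesLinearOn (fun v : E => φ (lieExp (G := G) v))
        (ContinuousLinearMap.id ℝ E) (Metric.closedBall 0 r) (1 / 2) := by
      intro v hv w hw
      simpa using happ v w (by simpa using hv) (by simpa using hw)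
    let R : (ContinuousLinearMap.id ℝ E).NonlinearRightInverse :=
      { toFun := id, nnnorm := 1, bound' := fun y => by simp, right_inv' := fun y => rfl }
    have hs := hA.surjOn_closedBall_of_nonlinearRightInverse R (ε := r) (b := 0) hr.le subset_rfl
    obtain ⟨v, hv, hvh⟩ := hs (show φ h ∈ _ by
      rw [Metric.mem_closedBall, dist_eq_norm, h0]
      refine hhr.trans (le_of_eq ?_)
      simp only [R]
      norm_num
      ring)
    have hv' : ‖v‖ ≤ r := by simpa using hv
    have hvh' : φ (lieExp (G := G) v) = φ h := hvh
    refine ⟨v, ?_, (φ.injOn (hsrc v hv') hh hvh').symm⟩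
    have h1 := happ0 v hv'
    rw [hvh'] at h1
    have h2 := norm_le_norm_sub_add v (φ h - φ 1)
    rw [norm_sub_rev] at h2
    linarith

end HomogeneousSpace

end

/-! ### Riemannian distance in a chart -/

noncomputable section

open scoped Manifold ContDiff TensorProduct Bundle Topology ENNReal NNReal

namespace Manifold

open Bundle Set MeasureTheory Metric

variable {E : Type*} [NormedAddCommGroup E] [NormedSpace ℝ E]
  {M : Type*} [TopologicalSpace M] [ChartedSpace E M]
  [RiemannianBundle (fun (x : M) ↦ TangentSpace 𝓘(ℝ, E) x)]
  [IsManifold 𝓘(ℝ, E) 1 M]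
  [IsContinuousRiemannianBundle E (fun (x : M) ↦ TangentSpace 𝓘(ℝ, E) x)]

/-- The derivative of the inverse of a chart is locally bounded, as a map from the model space to
the Riemannian tangent spaces. -/
lemma exists_enorm_mfderivWithin_symm_extChartAt_apply_le (x₀ : M) : ∃ C : ℝ≥0,
    ∀ᶠ y in 𝓝[range 𝓘(ℝ, E)] (extChartAt 𝓘(ℝ, E) x₀ x₀), ∀ v : E,
      ‖mfderiv[range 𝓘(ℝ, E)] (extChartAt 𝓘(ℝ, E) x₀).symm y v‖ₑ ≤ C * ‖v‖ₑ := by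
  rcases eventually_enorm_mfderivWithin_symm_extChartAt_lt 𝓘(ℝ, E) x₀ with ⟨C, C_pos, hC⟩
  refine ⟨C, hC.mono fun y hy v => ?_⟩
  let : NormedAddCommGroup (TangentSpace 𝓘(ℝ, E) y) := normedAddCommGroupTangentSpaceVectorSpace y
  let : NormedSpace ℝ (TangentSpace 𝓘(ℝ, E) y) := normedSpaceTangentSpaceVectorSpace y
  refine le_trans ?_ (mul_le_mul_left hy.le _)
  exact ContinuousLinearMap.le_opENorm (E := TangentSpace 𝓘(ℝ, E) y) _ v

/-- The derivative of a chart is locally bounded, as a map from the Riemannian tangent spaces to the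
model space. -/
lemma exists_enorm_mfderiv_extChartAt_apply_le (x₀ : M) : ∃ C : ℝ≥0, 0 < C ∧
    ∀ᶠ y in 𝓝 x₀, ∀ v : TangentSpace 𝓘(ℝ, E) y,
      @enorm E _ (mfderiv% (extChartAt 𝓘(ℝ, E) x₀) y v) ≤ C * ‖v‖ₑ := by
  rcases eventually_enorm_mfderiv_extChartAt_lt 𝓘(ℝ, E) x₀ with ⟨C, C_pos, hC⟩
  refine ⟨C, C_pos, hC.mono fun y hy v => ?_⟩
  refine le_trans ?_ (mul_le_mul_left hy.le _)
  let := normedAddCommGroupTangentSpaceVectorSpace (extChartAt 𝓘(ℝ, E) x₀ y)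
  let := normedSpaceTangentSpaceVectorSpace (extChartAt 𝓘(ℝ, E) x₀ y)
  exact ContinuousLinearMap.le_opENorm (F := TangentSpace 𝓘(ℝ, E) (extChartAt 𝓘(ℝ, E) x₀ y)) _ v

/-- Near a point, the Riemannian distance is bounded by a multiple of the distance in the chart,
by following the segment in the chart. -/
lemma exists_riemannianEDist_le_edist_extChartAt (x₀ : M) :
    ∃ C : ℝ≥0, ∃ U ∈ 𝓝 x₀, ∀ x ∈ U, ∀ y ∈ U, riemannianEDist 𝓘(ℝ, E) x y
      ≤ C * edist (extChartAt 𝓘(ℝ, E) x₀ x) (extChartAt 𝓘(ℝ, E) x₀ y) := by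
  obtain ⟨C, hC⟩ := exists_enorm_mfderivWithin_symm_extChartAt_apply_le (E := E) x₀
  obtain ⟨r, r_pos, hr⟩ : ∃ r > 0,
      ball (extChartAt 𝓘(ℝ, E) x₀ x₀) r ∩ range 𝓘(ℝ, E) ⊆ (extChartAt 𝓘(ℝ, E) x₀).target ∩
        {y | ∀ v : E,
          ‖mfderiv[range 𝓘(ℝ, E)] (extChartAt 𝓘(ℝ, E) x₀).symm y v‖ₑ ≤ C * ‖v‖ₑ} :=
    mem_nhdsWithin_iff.1 (Filter.inter_mem (extChartAt_target_mem_nhdsWithin x₀) hC)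
  have A : (extChartAt 𝓘(ℝ, E) x₀) ⁻¹' (ball (extChartAt 𝓘(ℝ, E) x₀ x₀) r) ∈ 𝓝 x₀ :=
    (continuousAt_extChartAt (I := 𝓘(ℝ, E)) x₀).preimage_mem_nhds (ball_mem_nhds _ r_pos)
  refine ⟨C, _, Filter.inter_mem A (extChartAt_source_mem_nhds (I := 𝓘(ℝ, E)) x₀), ?_⟩
  rintro x ⟨hx, hxs⟩ y ⟨hy, hys⟩
  let η := ContinuousAffineMap.lineMap (R := ℝ) (extChartAt 𝓘(ℝ, E) x₀ x) (extChartAt 𝓘(ℝ, E) x₀ y)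
  set γ := (extChartAt 𝓘(ℝ, E) x₀).symm ∘ η
  have hη : Icc 0 1 ⊆ ⇑η ⁻¹' ((extChartAt 𝓘(ℝ, E) x₀).target ∩
        {y | ∀ v : E,
          ‖mfderiv[range 𝓘(ℝ, E)] (extChartAt 𝓘(ℝ, E) x₀).symm y v‖ₑ ≤ C * ‖v‖ₑ}) := by
    simp only [← image_subset_iff, ContinuousAffineMap.coe_lineMap_eq,
     ← segment_eq_image_lineMap, η]
    apply Subset.trans _ hr
    exact ((convex_ball _ _).inter (𝓘(ℝ, E)).convex_range).segment_subset ⟨hx, by simp⟩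
      ⟨hy, by simp⟩
  simp only [preimage_inter, subset_inter_iff] at hη
  have η_smooth : CMDiff[Icc 0 1] 1 η := by
    apply ContMDiff.contMDiffOn
    rw [contMDiff_iff_contDiff]
    exact ContinuousAffineMap.contDiff _
  have : riemannianEDist 𝓘(ℝ, E) x y ≤ pathELength 𝓘(ℝ, E) γ 0 1 := by
    apply riemannianEDist_le_pathELength _ _ _ zero_le_one
    · exact (contMDiffOn_extChartAt_symm x₀).comp η_smooth hη.1
    · simp only [γ, η, Function.comp_apply, ContinuousAffineMap.coe_lineMap_eq,
        AffineMap.lineMap_apply_zero]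
      exact (extChartAt 𝓘(ℝ, E) x₀).left_inv hxs
    · simp only [γ, η, Function.comp_apply, ContinuousAffineMap.coe_lineMap_eq,
        AffineMap.lineMap_apply_one]
      exact (extChartAt 𝓘(ℝ, E) x₀).left_inv hys
  apply this.trans
  rw [← lintegral_fderiv_lineMap_eq_edist, pathELength_eq_lintegral_mfderivWithin_Icc,
    ← lintegral_const_mul' _ _ ENNReal.coe_ne_top]
  apply setLIntegral_mono' measurableSet_Icc (fun t ht ↦ ?_)
  have : mfderiv[Icc 0 1] γ t =
      (mfderiv[range 𝓘(ℝ, E)] (extChartAt 𝓘(ℝ, E) x₀).symm (η t)) ∘L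
        (mfderiv[Icc 0 1] η t) := by
    apply mfderivWithin_comp
    · exact mdifferentiableWithinAt_extChartAt_symm (hη.1 ht)
    · exact η_smooth.mdifferentiableOn one_ne_zero t ht
    · exact hη.1.trans (preimage_mono (extChartAt_target_subset_range x₀))
    · rw [uniqueMDiffWithinAt_iff_uniqueDiffWithinAt]
      exact uniqueDiffOn_Icc zero_lt_one t ht
  have : mfderiv[Icc 0 1] γ t 1 =
      (mfderiv[range 𝓘(ℝ, E)] (extChartAt 𝓘(ℝ, E) x₀).symm (η t)) (mfderiv[Icc 0 1] η t 1) :=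
    congr($this 1)
  rw [this]
  refine (hη.2 ht _).trans (le_of_eq ?_)
  rw [mfderivWithin_eq_fderivWithin]
  rfl

/-- Near a point, the distance in the chart is bounded by a multiple of the Riemannian distance: a
short path stays in a small Riemannian ball, on which the derivative of the chart is bounded. -/
lemma exists_edist_extChartAt_le_riemannianEDist [RegularSpace M] (x₀ : M) {V : Set M}
    (hV : V ∈ 𝓝 x₀) :
    ∃ C : ℝ≥0, ∃ r : ℝ≥0, 0 < r ∧ ∃ U ∈ 𝓝 x₀, ∀ x ∈ U, ∀ y, riemannianEDist 𝓘(ℝ, E) x y < r →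
      y ∈ V ∧ edist (extChartAt 𝓘(ℝ, E) x₀ x) (extChartAt 𝓘(ℝ, E) x₀ y)
        ≤ C * riemannianEDist 𝓘(ℝ, E) x y := by
  obtain ⟨C, C_pos, hC⟩ := exists_enorm_mfderiv_extChartAt_apply_le (E := E) x₀
  obtain ⟨c, hc, hcS⟩ := setOfPred_riemannianEDist_lt_subset_nhds 𝓘(ℝ, E)
    (Filter.inter_mem (Filter.inter_mem hV hC)
      (extChartAt_source_mem_nhds (I := 𝓘(ℝ, E)) x₀))
  have hc2 : (0 : ℝ≥0) < c / 2 := by positivity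
  refine ⟨C, c / 2, hc2, {x | riemannianEDist 𝓘(ℝ, E) x₀ x < (c / 2 : ℝ≥0)},
    eventually_riemannianEDist_lt 𝓘(ℝ, E) x₀ (by exact_mod_cast hc2), fun x hx y hxy => ?_⟩
  have hadd : ((c / 2 : ℝ≥0) : ℝ≥0∞) + (c / 2 : ℝ≥0) = c := by
    rw [← ENNReal.coe_add, add_halves]
  have hball : ∀ z, riemannianEDist 𝓘(ℝ, E) x z < (c / 2 : ℝ≥0) →
      z ∈ V ∧ (∀ v : TangentSpace 𝓘(ℝ, E) z,
        @enorm E _ (mfderiv% (extChartAt 𝓘(ℝ, E) x₀) z v) ≤ C * ‖v‖ₑ) ∧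
        z ∈ (extChartAt 𝓘(ℝ, E) x₀).source := by
    intro z hz
    have : riemannianEDist 𝓘(ℝ, E) x₀ z < c := by
      refine (riemannianEDist_triangle (y := x)).trans_lt ?_
      rw [← hadd]
      exact ENNReal.add_lt_add hx hz
    obtain ⟨⟨h1, h2⟩, h3⟩ := hcS this
    exact ⟨h1, h2, h3⟩
  refine ⟨(hball y hxy).1, ?_⟩
  have key : ∀ r' : ℝ≥0∞, riemannianEDist 𝓘(ℝ, E) x y < r' → r' ≤ (c / 2 : ℝ≥0) →
      edist (extChartAt 𝓘(ℝ, E) x₀ x) (extChartAt 𝓘(ℝ, E) x₀ y) ≤ C * r' := by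
    intro r' hr' hrc
    rcases exists_lt_locally_constant_of_riemannianEDist_lt hr' zero_lt_one
      with ⟨γ, hγx, hγy, γ_smooth, hγ, -⟩
    have hmem : ∀ t ∈ Icc (0 : ℝ) 1, riemannianEDist 𝓘(ℝ, E) x (γ t) < (c / 2 : ℝ≥0) := by
      intro t ht
      calc riemannianEDist 𝓘(ℝ, E) x (γ t) ≤ pathELength 𝓘(ℝ, E) γ 0 t :=
            riemannianEDist_le_pathELength γ_smooth.contMDiffOn hγx rfl ht.1
        _ ≤ pathELength 𝓘(ℝ, E) γ 0 1 := pathELength_mono le_rfl ht.2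
        _ < (c / 2 : ℝ≥0) := hγ.trans_le hrc
    let γ' := extChartAt 𝓘(ℝ, E) x₀ ∘ γ
    have hsrc : ∀ t ∈ Icc (0 : ℝ) 1, γ t ∈ (chartAt E x₀).source := fun t ht => by
      simpa [extChartAt_source] using (hball _ (hmem t ht)).2.2
    have hCD : CMDiff[Icc 0 1] 1 γ' :=
      contMDiffOn_extChartAt.comp (I' := 𝓘(ℝ, E)) (t := (chartAt E x₀).source)
        γ_smooth.contMDiffOn (fun t ht => hsrc t ht)
    have hle : ‖γ' 1 - γ' 0‖ₑ ≤ C * r' := by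
      calc
        ‖γ' 1 - γ' 0‖ₑ
      _ ≤ ∫⁻ t in Icc 0 1, ‖derivWithin γ' (Icc 0 1) t‖ₑ := by
        apply enorm_sub_le_lintegral_derivWithin_Icc_of_contDiffOn_Icc _ zero_le_one
        rwa [← contMDiffOn_iff_contDiffOn]
      _ = ∫⁻ t in Icc 0 1, @enorm E _ (mfderiv[Icc 0 1] γ' t 1) := by
        simp_rw [← fderivWithin_derivWithin, mfderivWithin_eq_fderivWithin]
        rfl
      _ ≤ ∫⁻ t in Icc 0 1, C * ‖mfderiv[Icc 0 1] γ t 1‖ₑ := by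
        apply setLIntegral_mono' measurableSet_Icc (fun t ht ↦ ?_)
        have : mfderiv[Icc 0 1] γ' t =
            (mfderiv% (extChartAt 𝓘(ℝ, E) x₀) (γ t)) ∘L (mfderiv[Icc 0 1] γ t) := by
          apply mfderiv_comp_mfderivWithin
          · exact mdifferentiableAt_extChartAt (hsrc t ht)
          · exact (γ_smooth.mdifferentiable one_ne_zero).mdifferentiableOn _ ht
          · rw [uniqueMDiffWithinAt_iff_uniqueDiffWithinAt]
            exact uniqueDiffOn_Icc zero_lt_one _ ht
        have : mfderiv[Icc 0 1] γ' t 1 =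
            (mfderiv% (extChartAt 𝓘(ℝ, E) x₀) (γ t)) (mfderiv[Icc 0 1] γ t 1) :=
          congr($this 1)
        rw [this]
        exact (hball _ (hmem t ht)).2.1 _
      _ = C * pathELength 𝓘(ℝ, E) γ 0 1 := by
        rw [lintegral_const_mul' _ _ ENNReal.coe_ne_top,
            pathELength_eq_lintegral_mfderivWithin_Icc]
      _ ≤ C * r' := by gcongr
    rw [edist_comm, edist_eq_enorm_sub]
    simpa only [γ', Function.comp_apply, hγx, hγy] using hle
  have hC0 : (C : ℝ≥0∞) ≠ 0 := by exact_mod_cast C_pos.ne'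
  refine le_of_forall_gt_imp_ge_of_dense fun b hb => ?_
  have hb' : riemannianEDist 𝓘(ℝ, E) x y < b / C := by
    rw [ENNReal.lt_div_iff_mul_lt (Or.inl hC0) (Or.inl ENNReal.coe_ne_top), mul_comm]
    exact hb
  have h1 := key (min (b / C) (c / 2 : ℝ≥0)) (lt_min hb' hxy) (min_le_right _ _)
  refine h1.trans ?_
  calc (C : ℝ≥0∞) * min (b / C) (c / 2 : ℝ≥0) ≤ C * (b / C) := by gcongr; exact min_le_left _ _
    _ = b := ENNReal.mul_div_cancel hC0 ENNReal.coe_ne_top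

end Manifold

end

/-! ### Displacements by exponentials and the Riemannian distance -/

noncomputable section

open scoped Manifold ContDiff TensorProduct Bundle Topology ENNReal NNReal

namespace HomogeneousSpace

open Bundle Manifold

/-- A smooth map of two variables is locally Lipschitz in the second one, uniformly in the first,
when read in charts. -/
lemma exists_edist_extChartAt_le_of_contMDiffAt
    {E : Type*} [NormedAddCommGroup E] [NormedSpace ℝ E]
    {M : Type*} [TopologicalSpace M] [ChartedSpace E M] [IsManifold 𝓘(ℝ, E) ∞ M]
    {F : M × M → M} {a b c : M}
    (hF : ContMDiffAt (𝓘(ℝ, E).prod 𝓘(ℝ, E)) 𝓘(ℝ, E) ∞ F (a, b)) (hc : F (a, b) = c) :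
    ∃ K : ℝ≥0, ∃ U ∈ 𝓝 a, ∃ N ∈ 𝓝 b, ∀ x ∈ U, ∀ y ∈ N, ∀ y' ∈ N,
      edist (extChartAt 𝓘(ℝ, E) c (F (x, y))) (extChartAt 𝓘(ℝ, E) c (F (x, y')))
        ≤ K * edist (extChartAt 𝓘(ℝ, E) b y) (extChartAt 𝓘(ℝ, E) b y') := by
  subst hc
  set α := extChartAt 𝓘(ℝ, E) a
  set β := extChartAt 𝓘(ℝ, E) b
  set χ := extChartAt 𝓘(ℝ, E) (F (a, b))
  let f : E × E → E := fun p => χ (F (α.symm p.1, β.symm p.2))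
  have hsymm : ∀ z : M, ContMDiffAt 𝓘(ℝ, E) 𝓘(ℝ, E) ∞ (extChartAt 𝓘(ℝ, E) z).symm
      (extChartAt 𝓘(ℝ, E) z z) := fun z =>
    (contMDiffOn_extChartAt_symm (I := 𝓘(ℝ, E)) (n := ∞) z).contMDiffAt
      (extChartAt_target_mem_nhds (I := 𝓘(ℝ, E)) z)
  have h1 : ContMDiffAt 𝓘(ℝ, E × E) 𝓘(ℝ, E) ∞ (fun p : E × E => α.symm p.1) (α a, β b) :=
    ContMDiffAt.comp (g := α.symm) (f := Prod.fst) (α a, β b) (hsymm a) contDiffAt_fst.contMDiffAt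
  have h2 : ContMDiffAt 𝓘(ℝ, E × E) 𝓘(ℝ, E) ∞ (fun p : E × E => β.symm p.2) (α a, β b) :=
    ContMDiffAt.comp (g := β.symm) (f := Prod.snd) (α a, β b) (hsymm b) contDiffAt_snd.contMDiffAt
  have h3 := h1.prodMk h2
  have ha : α.symm (α a) = a := extChartAt_to_inv (I := 𝓘(ℝ, E)) a
  have hb : β.symm (β b) = b := extChartAt_to_inv (I := 𝓘(ℝ, E)) b
  have h4 : ContMDiffAt 𝓘(ℝ, E × E) 𝓘(ℝ, E) ∞ (fun p : E × E => F (α.symm p.1, β.symm p.2))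
      (α a, β b) := by
    refine ContMDiffAt.comp (g := F) (α a, β b) ?_ h3
    simp only [ha, hb]
    exact hF
  have h5 : ContMDiffAt 𝓘(ℝ, E × E) 𝓘(ℝ, E) ∞ f (α a, β b) := by
    refine ContMDiffAt.comp (g := χ) (α a, β b) ?_ h4
    simp only [ha, hb]
    exact contMDiffAt_extChartAt
  obtain ⟨K, t, ht, hK⟩ := (h5.contDiffAt.of_le
    (show (1 : ℕ∞ω) ≤ (∞ : ℕ∞ω) from ENat.LEInfty.out)).exists_lipschitzOnWith
  have hcont : ContinuousAt (fun p : M × M => (α p.1, β p.2)) (a, b) :=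
    ContinuousAt.prodMk
      (ContinuousAt.comp (g := α) (continuousAt_extChartAt (I := 𝓘(ℝ, E)) a) continuousAt_fst)
      (ContinuousAt.comp (g := β) (continuousAt_extChartAt (I := 𝓘(ℝ, E)) b) continuousAt_snd)
  obtain ⟨U, hU, N, hN, hUN⟩ := mem_nhds_prod_iff.1 (hcont.preimage_mem_nhds ht)
  refine ⟨K, _, Filter.inter_mem hU (extChartAt_source_mem_nhds (I := 𝓘(ℝ, E)) a), _,
    Filter.inter_mem hN (extChartAt_source_mem_nhds (I := 𝓘(ℝ, E)) b), ?_⟩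
  rintro x ⟨hx, hxs⟩ y ⟨hy, hys⟩ y' ⟨hy', hys'⟩
  have hl := hK (@hUN (x, y) ⟨hx, hy⟩) (@hUN (x, y') ⟨hx, hy'⟩)
  simp only [f] at hl
  rw [α.left_inv hxs, β.left_inv hys, β.left_inv hys', Prod.edist_eq] at hl
  simpa using hl

variable {E : Type*} [NormedAddCommGroup E] [NormedSpace ℝ E] [FiniteDimensional ℝ E]
  {G : Type*} [TopologicalSpace G] [T2Space G] [ChartedSpace E G] [Group G]
  [LieGroup 𝓘(ℝ, E) ∞ G]

variable (G) in
lemma tendsto_lieExp_zero : Filter.Tendsto (fun v : E => lieExp (G := G) v) (𝓝 0) (𝓝 1) := by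
  obtain ⟨r, hr, hsrc, hup, -⟩ := exists_lieExp_bilipschitz (E := E) (G := G)
  set φ := extChartAt 𝓘(ℝ, E) (1 : G)
  have hr' : ∀ᶠ v : E in 𝓝 0, ‖v‖ ≤ r := by
    filter_upwards [Metric.closedBall_mem_nhds (0 : E) hr] with v hv
    simpa using hv
  have h1 : Filter.Tendsto (fun v : E => φ (lieExp (G := G) v)) (𝓝 0) (𝓝 (φ 1)) := by
    rw [tendsto_iff_norm_sub_tendsto_zero]
    have h2 : Filter.Tendsto (fun v : E => 2 * ‖v‖) (𝓝 0) (𝓝 0) := by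
      have : Continuous (fun v : E => 2 * ‖v‖) := by fun_prop
      simpa using this.tendsto 0
    exact squeeze_zero' (Filter.Eventually.of_forall fun v => norm_nonneg _)
      (hr'.mono fun v hv => hup v hv) h2
  have h3 : Filter.Tendsto (fun v : E => φ.symm (φ (lieExp (G := G) v))) (𝓝 0) (𝓝 1) := by
    have h4 : Filter.Tendsto φ.symm (𝓝 (φ 1)) (𝓝 1) := by
      have := continuousAt_extChartAt_symm (I := 𝓘(ℝ, E)) (1 : G)
      rwa [ContinuousAt, extChartAt_to_inv] at this
    exact h4.comp h1
  refine h3.congr' (hr'.mono fun v hv => ?_)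
  exact φ.left_inv (hsrc v hv)

section Riemannian

variable [RiemannianBundle (fun (x : G) ↦ TangentSpace 𝓘(ℝ, E) x)]

/-- At the point `k`, displacements by exponentials and the Riemannian distance are comparable up
to the factor `C`, on the scale `r`. -/
def DisplacementBound (C r : ℝ≥0) (k : G) : Prop :=
  (∀ v : E, ‖v‖ₑ ≤ r → riemannianEDist 𝓘(ℝ, E) k (lieExp (G := G) v * k) ≤ C * ‖v‖ₑ) ∧
    ∀ h, riemannianEDist 𝓘(ℝ, E) k h < r →
      ∃ v : E, ‖v‖ₑ ≤ C * riemannianEDist 𝓘(ℝ, E) k h ∧ h = lieExp (G := G) v * k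

lemma DisplacementBound.mono {C C' r r' : ℝ≥0} {k : G}
    (h : DisplacementBound (E := E) C r k) (hC : C ≤ C') (hr : r' ≤ r) :
    DisplacementBound (E := E) C' r' k := by
  have hr' : (r' : ℝ≥0∞) ≤ r := by exact_mod_cast hr
  refine ⟨fun v hv => (h.1 v (hv.trans hr')).trans (by gcongr), fun g hg => ?_⟩
  obtain ⟨v, hv, hvg⟩ := h.2 g (hg.trans_le hr')
  exact ⟨v, hv.trans (by gcongr), hvg⟩

variable [IsContinuousRiemannianBundle E (fun (x : G) ↦ TangentSpace 𝓘(ℝ, E) x)]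

/-- The comparison holds near every point: multiplication and division in `G` are smooth, hence
Lipschitz in charts, and `exp` is bi-Lipschitz near `0`. -/
lemma exists_displacementBound_nhds (k₀ : G) :
    ∃ C r : ℝ≥0, 0 < r ∧ ∀ᶠ k in 𝓝 k₀, DisplacementBound (E := E) C r k := by
  have hG : IsTopologicalGroup G := topologicalGroup_of_lieGroup 𝓘(ℝ, E) ∞
  have : IsManifold 𝓘(ℝ, E) 1 G := inferInstance
  obtain ⟨ρ, hρ, hsrc, hup, -, hsurj⟩ := exists_lieExp_bilipschitz (E := E) (G := G)
  have hmul : ContMDiff (𝓘(ℝ, E).prod 𝓘(ℝ, E)) 𝓘(ℝ, E) ∞ (fun p : G × G => p.2 * p.1) :=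
    contMDiff_snd.mul contMDiff_fst
  have hdiv : ContMDiff (𝓘(ℝ, E).prod 𝓘(ℝ, E)) 𝓘(ℝ, E) ∞ (fun p : G × G => p.2 * p.1⁻¹) :=
    contMDiff_snd.mul contMDiff_fst.inv
  obtain ⟨K₁, U₁, hU₁, N₁, hN₁, hK₁⟩ := exists_edist_extChartAt_le_of_contMDiffAt
    (hmul (k₀, 1)) (one_mul k₀)
  obtain ⟨K₂, U₂, hU₂, N₂, hN₂, hK₂⟩ := exists_edist_extChartAt_le_of_contMDiffAt
    (hdiv (k₀, k₀)) (mul_inv_cancel k₀)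
  obtain ⟨C₁, W₁, hW₁, hC₁⟩ := exists_riemannianEDist_le_edist_extChartAt (E := E) k₀
  -- for `k` and `h` near `k₀` the quotient `h * k⁻¹` lies in the domain of the chart at `1`
  obtain ⟨U₃, hU₃, N₃, hN₃, hUN₃⟩ := mem_nhds_prod_iff.1
    ((hdiv.continuous.continuousAt (x := (k₀, k₀))).preimage_mem_nhds (by
      simpa only [mul_inv_cancel] using extChartAt_source_mem_nhds (I := 𝓘(ℝ, E)) (1 : G)))
  obtain ⟨C₂, r₂, hr₂, W₂, hW₂, hC₂⟩ := exists_edist_extChartAt_le_riemannianEDist (E := E) k₀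
    (Filter.inter_mem hN₂ hN₃)
  -- for `v` small and `k` near `k₀` the point `exp v * k` is near `k₀`
  obtain ⟨A, hA, B, hB, hAB⟩ := mem_nhds_prod_iff.1
    ((hmul.continuous.continuousAt (x := (k₀, 1))).preimage_mem_nhds (by
      simpa only [one_mul] using hW₁))
  obtain ⟨δ, hδ, hδB⟩ := Metric.nhds_basis_closedBall.eventually_iff.1
    ((tendsto_lieExp_zero (E := E) G).eventually (Filter.inter_mem hB hN₁))
  set r₁ : ℝ≥0 := (min δ ρ).toNNReal
  have hr₁ : 0 < r₁ := Real.toNNReal_pos.2 (lt_min hδ hρ)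
  set r₃ : ℝ≥0 := (ρ / 2).toNNReal / (K₂ * C₂ + 1)
  have hr₃ : 0 < r₃ := div_pos (Real.toNNReal_pos.2 (half_pos hρ)) (by positivity)
  refine ⟨max (C₁ * (K₁ * 2)) (2 * (K₂ * C₂)), min r₁ (min r₂ r₃), by positivity, ?_⟩
  filter_upwards [hU₁, hU₂, hU₃, hW₁, hW₂, hN₂, hA] with k hkU₁ hkU₂ hkU₃ hkW₁ hkW₂ hkN₂ hkA
  constructor
  · intro v hv
    have hv' : ‖v‖ ≤ min δ ρ := by
      have h1 : ‖v‖ₑ ≤ r₁ := hv.trans (by exact_mod_cast min_le_left _ _)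
      rw [← ofReal_norm, ENNReal.ofReal_le_iff_le_toReal ENNReal.coe_ne_top] at h1
      exact h1.trans_eq (Real.coe_toNNReal _ (lt_min hδ hρ).le)
    have hvB := hδB (show v ∈ Metric.closedBall 0 δ by simpa using hv'.trans (min_le_left _ _))
    have h1 := hC₁ k hkW₁ _ (show lieExp (G := G) v * k ∈ W₁ from
      @hAB (k, lieExp (G := G) v) ⟨hkA, hvB.1⟩)
    have h2 := hK₁ k hkU₁ 1 (mem_of_mem_nhds hN₁) _ hvB.2
    simp only [one_mul] at h2
    have h3 : edist (extChartAt 𝓘(ℝ, E) (1 : G) 1) (extChartAt 𝓘(ℝ, E) (1 : G)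
        (lieExp (G := G) v)) ≤ 2 * ‖v‖ₑ := by
      rw [edist_comm, edist_eq_enorm_sub, ← ofReal_norm, ← ofReal_norm,
        show (2 : ℝ≥0∞) = ENNReal.ofReal 2 by simp, ← ENNReal.ofReal_mul two_pos.le]
      exact ENNReal.ofReal_le_ofReal (hup v (hv'.trans (min_le_right _ _)))
    calc riemannianEDist 𝓘(ℝ, E) k (lieExp (G := G) v * k)
        ≤ C₁ * (K₁ * (2 * ‖v‖ₑ)) := h1.trans (by gcongr; exact h2.trans (by gcongr))
      _ = ((C₁ * (K₁ * 2) : ℝ≥0) : ℝ≥0∞) * ‖v‖ₑ := by push_cast; ring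
      _ ≤ _ := by gcongr; exact le_max_left _ _
  · intro h hh
    have hh₂ : riemannianEDist 𝓘(ℝ, E) k h < r₂ := hh.trans_le (by
      exact_mod_cast (min_le_right _ _).trans (min_le_left _ _))
    have hh₃ : riemannianEDist 𝓘(ℝ, E) k h < r₃ := hh.trans_le (by
      exact_mod_cast (min_le_right _ _).trans (min_le_right _ _))
    obtain ⟨⟨hhN₂, hhN₃⟩, h1⟩ := hC₂ k hkW₂ h hh₂
    have h2 := hK₂ k hkU₂ h hhN₂ k hkN₂
    simp only [mul_inv_cancel] at h2
    have hq : h * k⁻¹ ∈ (extChartAt 𝓘(ℝ, E) (1 : G)).source := @hUN₃ (k, h) ⟨hkU₃, hhN₃⟩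
    have h3 : ‖extChartAt 𝓘(ℝ, E) (1 : G) (h * k⁻¹) - extChartAt 𝓘(ℝ, E) (1 : G) 1‖ₑ
        ≤ ((K₂ * C₂ : ℝ≥0) : ℝ≥0∞) * riemannianEDist 𝓘(ℝ, E) k h := by
      rw [← edist_eq_enorm_sub]
      refine h2.trans ?_
      rw [edist_comm, ENNReal.coe_mul, mul_assoc]
      gcongr
    have h4 : ‖extChartAt 𝓘(ℝ, E) (1 : G) (h * k⁻¹) - extChartAt 𝓘(ℝ, E) (1 : G) 1‖ ≤ ρ / 2 := by
      have h5 : ‖extChartAt 𝓘(ℝ, E) (1 : G) (h * k⁻¹) - extChartAt 𝓘(ℝ, E) (1 : G) 1‖ₑ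
          ≤ (((K₂ * C₂ + 1) * r₃ : ℝ≥0) : ℝ≥0∞) := by
        refine h3.trans ?_
        rw [ENNReal.coe_mul (K₂ * C₂ + 1)]
        gcongr
        exact le_self_add
      rw [← ofReal_norm, ENNReal.ofReal_le_iff_le_toReal ENNReal.coe_ne_top] at h5
      refine h5.trans (le_of_eq ?_)
      simp only [r₃]
      rw [mul_div_cancel₀ _ (by positivity)]
      exact Real.coe_toNNReal _ (half_pos hρ).le
    obtain ⟨v, hv, hvh⟩ := hsurj _ hq h4
    refine ⟨v, ?_, by rw [← hvh]; simp⟩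
    have h6 : ‖v‖ₑ ≤ 2 * ‖extChartAt 𝓘(ℝ, E) (1 : G) (h * k⁻¹)
        - extChartAt 𝓘(ℝ, E) (1 : G) 1‖ₑ := by
      rw [← ofReal_norm, ← ofReal_norm,
        show (2 : ℝ≥0∞) = ENNReal.ofReal 2 by simp, ← ENNReal.ofReal_mul two_pos.le]
      exact ENNReal.ofReal_le_ofReal hv
    calc ‖v‖ₑ ≤ 2 * (((K₂ * C₂ : ℝ≥0) : ℝ≥0∞) * riemannianEDist 𝓘(ℝ, E) k h) :=
          h6.trans (by gcongr)
      _ = ((2 * (K₂ * C₂) : ℝ≥0) : ℝ≥0∞) * riemannianEDist 𝓘(ℝ, E) k h := by push_cast; ring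
      _ ≤ _ := by gcongr; exact le_max_right _ _

end Riemannian

end HomogeneousSpace

end

/-! ### Uniformity over a compact quotient -/

noncomputable section

open scoped Manifold ContDiff TensorProduct Bundle Topology

namespace HomogeneousSpace

open Bundle Manifold
open scoped NNReal ENNReal

section Contraction

variable {E : Type*} [NormedAddCommGroup E] [NormedSpace ℝ E]
  {M : Type*} [TopologicalSpace M] [ChartedSpace E M]
  [RiemannianBundle (fun (x : M) ↦ TangentSpace 𝓘(ℝ, E) x)]

/-- A `C¹` map whose derivative does not increase norms does not increase distances. -/
lemma riemannianEDist_map_le [IsManifold 𝓘(ℝ, E) 1 M] {f : M → M}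
    (hf : ContMDiff 𝓘(ℝ, E) 𝓘(ℝ, E) 1 f)
    (h : ∀ x (v : TangentSpace 𝓘(ℝ, E) x), ‖mfderiv 𝓘(ℝ, E) 𝓘(ℝ, E) f x v‖ₑ ≤ ‖v‖ₑ) (x y : M) :
    riemannianEDist 𝓘(ℝ, E) (f x) (f y) ≤ riemannianEDist 𝓘(ℝ, E) x y := by
  refine le_of_forall_gt fun r hr => ?_
  obtain ⟨γ, h0, h1, hγ, hl⟩ := exists_lt_of_riemannianEDist_lt hr
  refine (riemannianEDist_le_pathELength (hf.comp_contMDiffOn hγ) (by simp [h0]) (by simp [h1])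
    zero_le_one).trans_lt (lt_of_le_of_lt ?_ hl)
  rw [pathELength_eq_lintegral_mfderiv_Ioo, pathELength_eq_lintegral_mfderiv_Ioo]
  refine MeasureTheory.setLIntegral_mono_ae' measurableSet_Ioo
    (Filter.Eventually.of_forall fun t ht => ?_)
  have hγt : MDifferentiableAt 𝓘(ℝ, ℝ) 𝓘(ℝ, E) γ t :=
    (hγ.contMDiffAt (Icc_mem_nhds ht.1 ht.2)).mdifferentiableAt one_ne_zero
  have := mfderiv_comp_apply (I := 𝓘(ℝ, ℝ)) (I' := 𝓘(ℝ, E)) (I'' := 𝓘(ℝ, E)) t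
    (hf.contMDiffAt.mdifferentiableAt one_ne_zero) hγt (1 : ℝ)
  refine (le_of_eq ?_).trans (h _ (mfderiv 𝓘(ℝ, ℝ) 𝓘(ℝ, E) γ t (1 : ℝ)))
  exact congrArg (fun z : TangentSpace 𝓘(ℝ, E) (f (γ t)) => ‖z‖ₑ) this

lemma riemannianEDist_lt_top [IsManifold 𝓘(ℝ, E) 1 M]
    [IsContinuousRiemannianBundle E (fun (x : M) ↦ TangentSpace 𝓘(ℝ, E) x)]
    [PreconnectedSpace M] (x y : M) : riemannianEDist 𝓘(ℝ, E) x y < ⊤ := by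
  have hnear : ∀ z : M, ∀ᶠ w in 𝓝 z, riemannianEDist 𝓘(ℝ, E) z w < ⊤ := fun z =>
    eventually_riemannianEDist_lt 𝓘(ℝ, E) z ENNReal.zero_lt_top
  have hclopen : IsClopen {z : M | riemannianEDist 𝓘(ℝ, E) x z < ⊤} := by
    constructor
    · rw [← isOpen_compl_iff, isOpen_iff_mem_nhds]
      intro z hz
      filter_upwards [hnear z] with w hw hxw
      refine hz ((riemannianEDist_triangle (y := w)).trans_lt (ENNReal.add_lt_top.2 ⟨hxw, ?_⟩))
      rwa [riemannianEDist_comm]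
    · rw [isOpen_iff_mem_nhds]
      intro z hz
      filter_upwards [hnear z] with w hw
      exact riemannianEDist_triangle.trans_lt (ENNReal.add_lt_top.2 ⟨hz, hw⟩)
  have := hclopen.eq_univ ⟨x, by simp [riemannianEDist_self]⟩
  exact this.ge (Set.mem_univ y)

end Contraction

variable {E : Type*} [NormedAddCommGroup E] [NormedSpace ℝ E] [FiniteDimensional ℝ E]
  {G : Type*} [TopologicalSpace G] [T2Space G] [ChartedSpace E G] [Group G]
  [LieGroup 𝓘(ℝ, E) ∞ G]

lemma eventually_forall_of_coe_eq {H : Type*} [Group H] [TopologicalSpace H]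
    [ContinuousMul H] {Λ : Subgroup H} {P : H → Prop} (hP : ∀ k, ∀ γ ∈ Λ, P k → P (k * γ)) {k : H}
    (h : ∀ᶠ k' in 𝓝 k, P k') : ∀ᶠ x in 𝓝 (k : H ⧸ Λ), ∀ k' : H, (k' : H ⧸ Λ) = x → P k' := by
  filter_upwards [QuotientGroup.isOpenMap_coe.image_mem_nhds h]
  rintro x ⟨k₁, hk₁, rfl⟩ k' hk'
  have := hP k₁ (k₁⁻¹ * k') (QuotientGroup.eq.1 hk'.symm) hk₁
  simpa using this

/-- A property of the points of a topological group that holds locally with some value of a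
parameter, that is monotone in the parameter and invariant under right translations by `Λ`, holds
globally with some value of the parameter if `Λ` is cocompact. -/
lemma exists_forall_of_compactSpace_quotient {H : Type*} [Group H] [TopologicalSpace H]
    [ContinuousMul H] {Λ : Subgroup H} [CompactSpace (H ⧸ Λ)] {ι : Type*} [Preorder ι]
    [IsDirectedOrder ι] [Nonempty ι]
    {P : ι → H → Prop} (hmono : ∀ i j k, i ≤ j → P i k → P j k)
    (hinv : ∀ i k, ∀ γ ∈ Λ, P i k → P i (k * γ))
    (hloc : ∀ k, ∃ i, ∀ᶠ k' in 𝓝 k, P i k') : ∃ i, ∀ k, P i k := by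
  have h := (isCompact_univ (X := H ⧸ Λ)).induction_on
    (p := fun S => ∃ i, ∀ k : H, (k : H ⧸ Λ) ∈ S → P i k) ?_ ?_ ?_ ?_
  · obtain ⟨i, hi⟩ := h
    exact ⟨i, fun k => hi k (Set.mem_univ _)⟩
  · exact ⟨Classical.arbitrary ι, fun k hk => hk.elim⟩
  · rintro S T hST ⟨i, hi⟩
    exact ⟨i, fun k hk => hi k (hST hk)⟩
  · rintro S T ⟨i, hi⟩ ⟨j, hj⟩
    obtain ⟨n, hin, hjn⟩ := exists_ge_ge i j
    exact ⟨n, fun k hk => hk.elim (fun hk => hmono i n k hin (hi k hk))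
      (fun hk => hmono j n k hjn (hj k hk))⟩
  · intro x _
    obtain ⟨k, rfl⟩ := QuotientGroup.mk_surjective x
    obtain ⟨i, hi⟩ := hloc k
    exact ⟨_, mem_nhdsWithin_of_mem_nhds (eventually_forall_of_coe_eq (hinv i) hi), i,
      fun k' hk' => hk' k' rfl⟩

section Riemannian

variable [RiemannianBundle (fun (x : G) ↦ TangentSpace 𝓘(ℝ, E) x)]

lemma DisplacementBound.mul_right {C r : ℝ≥0} {k γ : G}
    (hγ : ∀ g h : G, riemannianEDist 𝓘(ℝ, E) (g * γ) (h * γ) = riemannianEDist 𝓘(ℝ, E) g h)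
    (h : DisplacementBound (E := E) C r k) : DisplacementBound (E := E) C r (k * γ) := by
  refine ⟨fun v hv => ?_, fun g hg => ?_⟩
  · rw [← mul_assoc, hγ]
    exact h.1 v hv
  · have hg' : riemannianEDist 𝓘(ℝ, E) (k * γ) g = riemannianEDist 𝓘(ℝ, E) k (g * γ⁻¹) := by
      rw [← hγ k, inv_mul_cancel_right]
    rw [hg'] at hg ⊢
    obtain ⟨v, hv, hvg⟩ := h.2 _ hg
    exact ⟨v, hv, by rw [← mul_assoc, ← hvg, inv_mul_cancel_right]⟩

lemma exists_forall_displacementBound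
    [IsContinuousRiemannianBundle E (fun (x : G) ↦ TangentSpace 𝓘(ℝ, E) x)]
    (Λ : Subgroup G) [CompactSpace (G ⧸ Λ)]
    (hΛ : ∀ γ ∈ Λ, ∀ g h : G,
      riemannianEDist 𝓘(ℝ, E) (g * γ) (h * γ) = riemannianEDist 𝓘(ℝ, E) g h) :
    ∃ C r : ℝ≥0, 0 < r ∧ ∀ k : G, DisplacementBound (E := E) C r k := by
  have hG : IsTopologicalGroup G := topologicalGroup_of_lieGroup 𝓘(ℝ, E) ∞
  obtain ⟨i, hi⟩ := exists_forall_of_compactSpace_quotient (Λ := Λ)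
    (P := fun (i : ℝ≥0 × {r : ℝ≥0 // 0 < r}ᵒᵈ) (k : G) =>
      DisplacementBound (E := E) i.1 (OrderDual.ofDual i.2).1 k)
    (fun i j k hij h => h.mono (Prod.le_def.1 hij).1 (Prod.le_def.1 hij).2)
    (fun i k γ hγ h => h.mul_right (hΛ γ hγ)) (fun k => by
      obtain ⟨C, r, hr, h⟩ := exists_displacementBound_nhds (E := E) k
      exact ⟨(C, OrderDual.toDual ⟨r, hr⟩), h⟩)
  exact ⟨i.1, (OrderDual.ofDual i.2).1, (OrderDual.ofDual i.2).2, hi⟩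

end Riemannian

/-- The translations of a compact quotient by a discrete subgroup by exponentials of small vectors
are distinguished by their value at any single point. -/
lemma exists_lieExp_smul_injOn (Λ : Subgroup G) [DiscreteTopology Λ] [CompactSpace (G ⧸ Λ)] :
    ∃ r : ℝ, 0 < r ∧ ∀ (x : G ⧸ Λ) (v w : E), ‖v‖ ≤ r → ‖w‖ ≤ r →
      lieExp (G := G) v • x = lieExp (G := G) w • x → v = w := by
  have hG : IsTopologicalGroup G := topologicalGroup_of_lieGroup 𝓘(ℝ, E) ∞
  obtain ⟨ρ, hρ, -, -, hinj, -⟩ := exists_lieExp_bilipschitz (E := E) (G := G)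
  obtain ⟨N, hN, hNΛ⟩ : ∃ N ∈ 𝓝 (1 : G), ∀ γ ∈ Λ, γ ∈ N → γ = 1 := by
    obtain ⟨N, hN, hN1⟩ := mem_nhds_subtype (Λ : Set G) (1 : Λ) {1} |>.1
      (mem_nhds_discrete.2 rfl)
    exact ⟨N, hN, fun γ hγ hγN => congrArg Subtype.val (hN1 (show (⟨γ, hγ⟩ : Λ) ∈ _ from hγN))⟩
  have hq : Filter.Tendsto (fun p : E × E => (lieExp (G := G) p.1)⁻¹ * lieExp (G := G) p.2)
      (𝓝 0) (𝓝 1) := by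
    have h := tendsto_lieExp_zero (E := E) G
    have h1 : Filter.Tendsto (fun p : E × E => lieExp (G := G) p.1) (𝓝 0) (𝓝 1) :=
      h.comp continuous_fst.continuousAt
    have h2 : Filter.Tendsto (fun p : E × E => lieExp (G := G) p.2) (𝓝 0) (𝓝 1) :=
      h.comp continuous_snd.continuousAt
    simpa using h1.inv.mul h2
  obtain ⟨i, hi⟩ := exists_forall_of_compactSpace_quotient (Λ := Λ)
    (P := fun (i : {r : ℝ // 0 < r}ᵒᵈ) (k : G) =>
      ∀ v w : E, ‖v‖ ≤ (OrderDual.ofDual i).1 → ‖w‖ ≤ (OrderDual.ofDual i).1 →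
        k⁻¹ * ((lieExp (G := G) v)⁻¹ * lieExp (G := G) w) * k ∈ Λ →
          lieExp (G := G) v = lieExp (G := G) w)
    (fun i j k hij h v w hv hw => h v w (hv.trans hij) (hw.trans hij))
    (fun i k γ hγ h v w hv hw hvw => h v w hv hw (by
      have := Λ.mul_mem (Λ.mul_mem hγ hvw) (Λ.inv_mem hγ)
      rw [mul_inv_rev] at this
      convert this using 1
      group))
    (fun k => by
      have hc : Continuous (fun p : G × G => p.1⁻¹ * p.2 * p.1) := by fun_prop
      obtain ⟨U, hU, N', hN', hUN⟩ := mem_nhds_prod_iff.1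
        (hc.continuousAt (x := (k, 1)) |>.preimage_mem_nhds (t := N) (by simpa using hN))
      obtain ⟨δ, hδ, hδN⟩ := Metric.nhds_basis_closedBall.eventually_iff.1 (hq.eventually hN')
      refine ⟨OrderDual.toDual ⟨δ, hδ⟩, Filter.mem_of_superset hU fun k' hk' v w hv hw hvw => ?_⟩
      have hmem := hδN (show (v, w) ∈ Metric.closedBall (0 : E × E) δ by
        simpa [Prod.norm_def] using ⟨hv, hw⟩)
      have h1 := hNΛ _ hvw (@hUN (k', _) ⟨hk', hmem⟩)
      have h2 : (lieExp (G := G) v)⁻¹ * lieExp (G := G) w = 1 := by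
        have := congrArg (fun z => k' * z * k'⁻¹) h1
        simpa [mul_assoc] using this
      exact inv_mul_eq_one.1 h2)
  refine ⟨min ρ (OrderDual.ofDual i).1, lt_min hρ (OrderDual.ofDual i).2,
    fun x v w hv hw hvw => ?_⟩
  obtain ⟨k, rfl⟩ := QuotientGroup.mk_surjective x
  refine hinj v w (hv.trans (min_le_left _ _)) (hw.trans (min_le_left _ _))
    (hi k v w (hv.trans (min_le_right _ _)) (hw.trans (min_le_right _ _)) ?_)
  have := QuotientGroup.eq.1 (show ((lieExp (G := G) v * k : G) : G ⧸ Λ)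
    = ((lieExp (G := G) w * k : G) : G ⧸ Λ) from hvw)
  simpa [mul_assoc] using this

end HomogeneousSpace

end

/-! ### The distance on the quotient -/

noncomputable section

open scoped Manifold ContDiff TensorProduct Bundle Topology

namespace HomogeneousSpace

open Bundle Manifold
open scoped NNReal ENNReal

variable {E : Type*} [NormedAddCommGroup E] [NormedSpace ℝ E]
  {G : Type*} [TopologicalSpace G] [ChartedSpace E G] [Group G]
  [LieGroup 𝓘(ℝ, E) ∞ G] {Λ : Subgroup G}

namespace QuotientMetric

/-- The Riemannian distance on `G` of the pullback of the metric. -/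
def edist (m : QuotientMetric E Λ) (g h : G) : ℝ≥0∞ :=
  letI : RiemannianBundle (fun x : G => TangentSpace 𝓘(ℝ, E) x) := ⟨m.metric.toRiemannianMetric⟩
  riemannianEDist 𝓘(ℝ, E) g h

lemma edist_mul_right_le (m : QuotientMetric E Λ) {γ : G} (hγ : γ ∈ Λ) (g h : G) :
    m.edist (g * γ) (h * γ) ≤ m.edist g h := by
  let : RiemannianBundle (fun x : G => TangentSpace 𝓘(ℝ, E) x) := ⟨m.metric.toRiemannianMetric⟩
  have : IsManifold 𝓘(ℝ, E) 1 G := inferInstance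
  refine riemannianEDist_map_le (f := fun z => z * γ)
    ((contMDiff_mul_right (I := 𝓘(ℝ, E)) (n := ∞) (a := γ)).of_le (by simp)) (fun x v => ?_) g h
  rw [← ofReal_norm, ← ofReal_norm, norm_eq_sqrt_real_inner, norm_eq_sqrt_real_inner]
  exact (congrArg (fun t => ENNReal.ofReal (Real.sqrt t)) (m.invariant γ hγ x v v)).le

lemma edist_mul_right (m : QuotientMetric E Λ) {γ : G} (hγ : γ ∈ Λ) (g h : G) :
    m.edist (g * γ) (h * γ) = m.edist g h := by
  refine (m.edist_mul_right_le hγ g h).antisymm ?_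
  simpa using m.edist_mul_right_le (Λ.inv_mem hγ) (g * γ) (h * γ)

lemma isContinuousRiemannianBundle (m : QuotientMetric E Λ) :
    letI : RiemannianBundle (fun x : G => TangentSpace 𝓘(ℝ, E) x) := ⟨m.metric.toRiemannianMetric⟩
    IsContinuousRiemannianBundle E (fun x : G => TangentSpace 𝓘(ℝ, E) x) :=
  letI : RiemannianBundle (fun x : G => TangentSpace 𝓘(ℝ, E) x) := ⟨m.metric.toRiemannianMetric⟩
  ⟨m.metric.inner, m.metric.toContinuousRiemannianMetric.continuous, fun _ _ _ => rfl⟩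

lemma edist_lt_top [PreconnectedSpace G] (m : QuotientMetric E Λ) (g h : G) :
    m.edist g h < ⊤ := by
  let : RiemannianBundle (fun x : G => TangentSpace 𝓘(ℝ, E) x) := ⟨m.metric.toRiemannianMetric⟩
  have : IsManifold 𝓘(ℝ, E) 1 G := inferInstance
  have := m.isContinuousRiemannianBundle
  exact riemannianEDist_lt_top g h

lemma dist_nonneg (m : QuotientMetric E Λ) (x y : G ⧸ Λ) : 0 ≤ m.dist x y :=
  ENNReal.toReal_nonneg

lemma dist_coe_le [PreconnectedSpace G] (m : QuotientMetric E Λ) (g h : G) :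
    m.dist (g : G ⧸ Λ) (h : G ⧸ Λ) ≤ (m.edist g h).toReal :=
  ENNReal.toReal_mono (m.edist_lt_top g h).ne
    (iInf_le_of_le g (iInf_le_of_le h (iInf_le_of_le rfl (iInf_le_of_le rfl le_rfl))))

lemma exists_edist_lt_of_dist_lt [PreconnectedSpace G] (m : QuotientMetric E Λ) {g : G} {y : G ⧸ Λ}
    {t : ℝ} (h : m.dist (g : G ⧸ Λ) y < t) :
    ∃ h : G, (h : G ⧸ Λ) = y ∧ m.edist g h < ENNReal.ofReal t := by
  obtain ⟨k, rfl⟩ := QuotientGroup.mk_surjective y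
  have hI : (⨅ (g' : G) (h' : G) (_ : (g' : G ⧸ Λ) = (g : G ⧸ Λ)) (_ : (h' : G ⧸ Λ) = (k : G ⧸ Λ)),
      m.edist g' h') < ENNReal.ofReal t := by
    refine (ENNReal.lt_ofReal_iff_toReal_lt (lt_of_le_of_lt ?_ (m.edist_lt_top g k)).ne).2 h
    exact iInf_le_of_le g (iInf_le_of_le k (iInf_le_of_le rfl (iInf_le_of_le rfl le_rfl)))
  simp only [iInf_lt_iff] at hI
  obtain ⟨g', h', hg, hh, hlt⟩ := hI
  have hγ := QuotientGroup.eq.1 hg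
  refine ⟨h' * (g'⁻¹ * g), (QuotientGroup.mk_mul_of_mem h' hγ).trans hh, ?_⟩
  rw [← m.edist_mul_right hγ] at hlt
  simpa using hlt

variable [FiniteDimensional ℝ E] [T2Space G] [PreconnectedSpace G] [DiscreteTopology Λ]
  [CompactSpace (G ⧸ Λ)]

/-- On a uniform scale, the distance between `x` and `exp v • x` is comparable to the norm of `v`,
and all points near `x` are of this form. -/
lemma exists_dist_estimates (m : QuotientMetric E Λ) : ∃ C r : ℝ, 0 < C ∧ 0 < r ∧
    (∀ (x : G ⧸ Λ) (v : E), ‖v‖ ≤ r → m.dist x (lieExp (G := G) v • x) ≤ C * ‖v‖) ∧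
    (∀ (x : G ⧸ Λ) (v : E), ‖v‖ ≤ r → ‖v‖ ≤ C * m.dist x (lieExp (G := G) v • x)) ∧
    ∀ x y : G ⧸ Λ, m.dist x y < r →
      ∃ v : E, ‖v‖ ≤ C * m.dist x y ∧ y = lieExp (G := G) v • x := by
  obtain ⟨C₀, r₀, hr₀, hC₀⟩ : ∃ C r : ℝ≥0, 0 < r ∧ ∀ k : G,
      (∀ v : E, ‖v‖ₑ ≤ r → m.edist k (lieExp (G := G) v * k) ≤ C * ‖v‖ₑ) ∧
      ∀ h, m.edist k h < r → ∃ v : E, ‖v‖ₑ ≤ C * m.edist k h ∧ h = lieExp (G := G) v * k := by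
    let : RiemannianBundle (fun x : G => TangentSpace 𝓘(ℝ, E) x) := ⟨m.metric.toRiemannianMetric⟩
    have := m.isContinuousRiemannianBundle
    exact exists_forall_displacementBound Λ fun γ hγ g h => m.edist_mul_right hγ g h
  obtain ⟨ρ, hρ, hinj⟩ := exists_lieExp_smul_injOn (E := E) Λ
  have hup : ∀ (x : G ⧸ Λ) (v : E), ‖v‖ ≤ r₀ → m.dist x (lieExp (G := G) v • x) ≤ C₀ * ‖v‖ := by
    intro x v hv
    obtain ⟨k, rfl⟩ := QuotientGroup.mk_surjective x
    refine (m.dist_coe_le k (lieExp (G := G) v * k)).trans ?_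
    have h1 := (hC₀ k).1 v (by
      rw [← ofReal_norm, ENNReal.ofReal_le_iff_le_toReal ENNReal.coe_ne_top]
      exact hv)
    simpa using ENNReal.toReal_mono (by finiteness) h1
  set C : ℝ := C₀ + 1
  have hC : 0 < C := by positivity
  have hnear : ∀ (x y : G ⧸ Λ) (δ : ℝ), m.dist x y < δ → δ ≤ r₀ →
      ∃ v : E, ‖v‖ ≤ C * δ ∧ y = lieExp (G := G) v • x := by
    intro x y δ hxy hδ
    have hδ0 : 0 ≤ δ := (m.dist_nonneg x y).trans hxy.le
    obtain ⟨k, rfl⟩ := QuotientGroup.mk_surjective x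
    obtain ⟨h, rfl, hh⟩ := m.exists_edist_lt_of_dist_lt hxy
    obtain ⟨v, hv, rfl⟩ := (hC₀ k).2 h (hh.trans_le (by
      rw [ENNReal.ofReal_le_iff_le_toReal ENNReal.coe_ne_top]
      exact hδ))
    refine ⟨v, ?_, rfl⟩
    have h1 : ‖v‖ₑ ≤ C₀ * ENNReal.ofReal δ := hv.trans (by gcongr)
    have h2 := ENNReal.toReal_mono (by finiteness) h1
    rw [toReal_enorm, ENNReal.toReal_mul, ENNReal.toReal_ofReal hδ0, ENNReal.coe_toReal] at h2
    refine h2.trans (mul_le_mul_of_nonneg_right ?_ hδ0)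
    simp [C]
  set r₁ : ℝ := min r₀ (ρ / C)
  have hr₁ : 0 < r₁ := lt_min (NNReal.coe_pos.2 hr₀) (by positivity)
  have hCr₁ : C * r₁ ≤ ρ := by
    rw [mul_comm, ← le_div_iff₀ hC]
    exact min_le_right _ _
  -- the vector does not depend on the upper bound for the distance, by uniqueness
  have hnear' : ∀ x y : G ⧸ Λ, m.dist x y < r₁ →
      ∃ v : E, ‖v‖ ≤ C * m.dist x y ∧ y = lieExp (G := G) v • x := by
    intro x y hxy
    obtain ⟨v, hv, hvy⟩ := hnear x y r₁ hxy (min_le_left _ _)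
    refine ⟨v, ?_, hvy⟩
    by_contra! hlt
    obtain ⟨δ, hδ, hδ'⟩ := exists_between (lt_min hxy ((lt_div_iff₀' hC).2 hlt))
    have hδr : δ ≤ r₁ := hδ'.le.trans (min_le_left _ _)
    obtain ⟨w, hw, hwy⟩ := hnear x y δ hδ (hδr.trans (min_le_left _ _))
    have hwv : w = v := hinj x w v
      (hw.trans ((mul_le_mul_of_nonneg_left hδr hC.le).trans hCr₁)) (hv.trans hCr₁) (hwy ▸ hvy)
    have := (lt_div_iff₀' hC).1 (hδ'.trans_le (min_le_right _ _))
    exact absurd (hwv ▸ hw) this.not_ge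
  refine ⟨max C (ρ / r₁), min r₁ ρ, lt_max_of_lt_left hC, lt_min hr₁ hρ, fun x v hv => ?_,
    fun x v hv => ?_, fun x y hxy => ?_⟩
  · refine (hup x v (hv.trans ((min_le_left _ _).trans (min_le_left _ _)))).trans
      (mul_le_mul_of_nonneg_right (le_max_of_le_left ?_) (norm_nonneg v))
    simp [C]
  · have hv' : ‖v‖ ≤ ρ := hv.trans (min_le_right _ _)
    rcases lt_or_ge (m.dist x (lieExp (G := G) v • x)) r₁ with h | h
    · obtain ⟨w, hw, hwv⟩ := hnear' _ _ h
      have := hinj x v w hv'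
        (hw.trans ((mul_le_mul_of_nonneg_left h.le hC.le).trans hCr₁)) hwv
      rw [← this] at hw
      exact hw.trans (mul_le_mul_of_nonneg_right (le_max_left _ _) (m.dist_nonneg _ _))
    · calc ‖v‖ ≤ ρ / r₁ * r₁ := by rwa [div_mul_cancel₀ _ hr₁.ne']
        _ ≤ max C (ρ / r₁) * m.dist x (lieExp (G := G) v • x) := by
          gcongr
          exact le_max_right _ _
  · obtain ⟨v, hv, hvy⟩ := hnear' x y (hxy.trans_le (min_le_left _ _))
    exact ⟨v, hv.trans (mul_le_mul_of_nonneg_right (le_max_left _ _) (m.dist_nonneg _ _)), hvy⟩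

end QuotientMetric

/-! ### Affine transformations and exponentials -/

namespace Aff

/-- The group automorphism `x ↦ g a(x) g⁻¹` of `G` along which the affine transformation
`x ↦ g a(x)` intertwines left translations. -/
def linearPart (f : Aff E Λ) : G ≃* G := f.a.toMulEquiv.trans (MulAut.conj f.g)

lemma contMDiff_conj (g : G) : ContMDiff 𝓘(ℝ, E) 𝓘(ℝ, E) ∞ (MulAut.conj g : G → G) :=
  (contMDiff_const.mul contMDiff_id).mul contMDiff_const

lemma mdifferentiableAt_linearPart (f : Aff E Λ) (x : G) :
    MDifferentiableAt 𝓘(ℝ, E) 𝓘(ℝ, E) f.linearPart x :=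
  ((contMDiff_conj f.g).comp f.a.smooth_toFun).mdifferentiable (by simp) x

lemma mdifferentiableAt_linearPart_symm (f : Aff E Λ) (x : G) :
    MDifferentiableAt 𝓘(ℝ, E) 𝓘(ℝ, E) f.linearPart.symm x := by
  have h := (f.a.smooth_invFun.comp (contMDiff_conj f.g⁻¹)).mdifferentiable (by simp) x
  refine h.congr_of_eventuallyEq (Filter.Eventually.of_forall fun y => ?_)
  simp [linearPart]

lemma D_eq (f : Aff E Λ) :
    f.D = (diffOne (E := E) f.linearPart.toMonoidHom).toLinearMap := by
  have h := diffOne_comp (E := E) (φ := (MulAut.conj f.g).toMonoidHom)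
    (ψ := f.a.toMulEquiv.toMonoidHom)
    ((contMDiff_conj f.g).mdifferentiable (by simp) 1)
    (f.a.smooth_toFun.mdifferentiable (by simp) 1)
  exact congrArg _ h.symm

lemma exists_D_inverse (f : Aff E Λ) :
    ∃ B : Module.End ℝ (GroupLieAlgebra 𝓘(ℝ, E) G), B * f.D = 1 ∧ f.D * B = 1 := by
  have hid : diffOne (E := E) (MonoidHom.id G) = .id ℝ _ := mfderiv_id
  have h1 := diffOne_comp (E := E) (φ := f.linearPart.symm.toMonoidHom)
    (ψ := f.linearPart.toMonoidHom) (f.mdifferentiableAt_linearPart_symm 1)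
    (f.mdifferentiableAt_linearPart 1)
  have h2 := diffOne_comp (E := E) (φ := f.linearPart.toMonoidHom)
    (ψ := f.linearPart.symm.toMonoidHom) (f.mdifferentiableAt_linearPart 1)
    (f.mdifferentiableAt_linearPart_symm 1)
  have h3 : f.linearPart.symm.toMonoidHom.comp f.linearPart.toMonoidHom = MonoidHom.id G := by
    ext; simp
  have h4 : f.linearPart.toMonoidHom.comp f.linearPart.symm.toMonoidHom = MonoidHom.id G := by
    ext; simp
  rw [h3, hid] at h1
  rw [h4, hid] at h2
  refine ⟨(diffOne (E := E) f.linearPart.symm.toMonoidHom).toLinearMap, ?_, ?_⟩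
  · rw [f.D_eq]
    ext v
    exact (DFunLike.congr_fun h1 v).symm
  · rw [f.D_eq]
    ext v
    exact (DFunLike.congr_fun h2 v).symm

variable [FiniteDimensional ℝ E] [T2Space G]

lemma toPerm_lieExp_smul (f : Aff E Λ) (v : GroupLieAlgebra 𝓘(ℝ, E) G) (x : G ⧸ Λ) :
    f.toPerm (lieExp v • x) = lieExp (f.D v) • f.toPerm x := by
  obtain ⟨k, rfl⟩ := QuotientGroup.mk_surjective x
  have h := map_lieExp f.linearPart.toMonoidHom (f.mdifferentiableAt_linearPart 1) v
  have hD : f.D v = diffOne (E := E) f.linearPart.toMonoidHom v := DFunLike.congr_fun f.D_eq v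
  rw [hD, ← h]
  refine congrArg (Quotient.mk'' : G → G ⧸ Λ) ?_
  change f.g * f.a.toMulEquiv (lieExp v * k)
    = f.g * f.a.toMulEquiv (lieExp v) * f.g⁻¹ * (f.g * f.a.toMulEquiv k)
  rw [map_mul]
  group

end Aff

end HomogeneousSpace

end


open HomogeneousSpace in
theorem mainTheorem7
    {E : Type*} [NormedAddCommGroup E] [NormedSpace ℝ E] [FiniteDimensional ℝ E]
    {G : Type*} [TopologicalSpace G] [T2Space G] [ConnectedSpace G] [ChartedSpace E G] [Group G]
    [LieGroup 𝓘(ℝ, E) ∞ G]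
    (Λ : Subgroup G) [DiscreteTopology Λ] [CompactSpace (G ⧸ Λ)]
    (ϑ : ℝ) (hϑ : 0 < ϑ)
    (f₀ : Aff E Λ) (hss : (RealSpectral.restrictWmin f₀.D).IsSemisimple) :
    ∃ ν : ℝ, 1 < ν ∧
      ∀ (m : QuotientMetric E Λ) (a : ℝ), 0 < a →
      ∀ (l : ℕ) (g : Fin l → Aff E Λ), IsEssential f₀ g →
      ∃ ε₀ : ℝ, 0 < ε₀ ∧
        ∀ ε : ℝ, 0 < ε → ε ≤ ε₀ →
        ∀ L : G ⧸ Λ → Set (G ⧸ Λ),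
          (∀ x, x ∈ L x ∧ L x ⊆ {y | m.dist x y < ε}) →
          (∀ x, L (f₀.toPerm.symm x) ⊆ f₀.toPerm.symm '' L x) →
          (∀ x, ∀ y ∈ L x, ∀ (n : ℕ) (k : Fin l),
            m.dist ((f₀.toPerm ^ (-(n : ℤ)) * (g k).toPerm * f₀.toPerm ^ n) x)
                ((f₀.toPerm ^ (-(n : ℤ)) * (g k).toPerm * f₀.toPerm ^ n) y)
              ≤ a * ν ^ n * m.dist x y ^ ϑ) →
          ∀ x, L x ⊆ fastStableLeaf f₀ x := by
  obtain ⟨B, hB₁, hB₂⟩ := f₀.exists_D_inverse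
  obtain ⟨ν, hν, H⟩ := RealSpectral.exists_rate_forall_eq_displacement (V := E)
    f₀.D B hB₁ hB₂ hϑ
  refine ⟨ν, hν, fun m a ha l g hg => ?_⟩
  obtain ⟨C, r, hC, hr, h1, h2, h3⟩ := m.exists_dist_estimates
  obtain ⟨ε₀, hε₀, hL⟩ := H f₀.toPerm (fun v x => lieExp (E := E) (G := G) v • x) m.dist C r hC hr
    (fun v x => f₀.toPerm_lieExp_smul v x) m.dist_nonneg h1 h2 h3 a ha l (fun k => (g k).toPerm)
    (fun k => (g k).D) (fun k v x => (g k).toPerm_lieExp_smul v x) hg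
  refine ⟨ε₀, hε₀, fun ε _ hε L hi hii hiii x y hy => ?_⟩
  obtain ⟨v, hv, hvy⟩ := hL L (fun x y hy => ((hi x).2 hy).trans_le hε) (fun x y hy => by
    obtain ⟨z, hz, hzy⟩ := hii (f₀.toPerm x) (by rwa [Equiv.symm_apply_apply] : y ∈ _)
    rwa [← hzy, Equiv.apply_symm_apply]) hiii x y hy
  exact ⟨v, hv, lieExp v, isLieExp_lieExp v, hvy⟩
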